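/- Let $N,J\ge 1$, $\mathcal N=\{1,\dots,N\}$, $\mathcal J=\{1,\dots,J\}$. Let $A(i)\in\mathbb R^{n\times n}$, $B(i)\in\mathbb R^{n\times m}$, $C(i)\in\mathbb R^{p\times n}$, $D(i)\in\mathbb R^{p\times m}$ for $i\in\mathcal N$; let $\Pi(s)=(\pi_{ij}(s))$, $s\in\mathcal J$, be $N\times N$ stochastic matrices (nonnegative entries, row sums one); let $p(0)$ be a probability vector on $\mathcal N$; and let $\Psi$ be a set of sequences $\psi=(\psi(1),\psi(2),\dots)$ in $\mathcal J$. On a probability space $(\Omega,\mathfrak F,\mathbf P)$ let there be given, for each $\psi\in\Psi$, a Markov chain $\theta=\theta_\psi:\mathbb N_0\times\Omega\to\mathcal N$ with initial distribution $p(0)$ and transition probabilities $\mathbf P\{\theta(k)=j\mid\theta(k-1)=i\}=\pi_{ij}(\psi(k))$, $k\ge 1$. The switched Markov jump linear system is the family, indexed by $\psi\in\Psi$, of the systems $$x(k+1)=A(\theta(k))x(k)+B(\theta(k))w(k),\qquad z(k)=C(\theta(k))x(k)+D(\theta(k))w(k),\qquad k\in\mathbb N_0 .$$ For $k\ge j$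 let $\Phi(k,j)=A(\theta(k-1))\cdots A(\theta(j))$, with $\Phi(j,j)=I$. The system is *uniformly exponentially mean square stable* if there are $c\ge 1$ and $0\le\lambda<1$ such that $\mathbf E[\Phi(k,j)^{T}\Phi(k,j)\mid\theta(j)=i]\le c\lambda^{k-j}I$ for all $\psi\in\Psi$, $i\in\mathcal N$ and $k\ge j\ge 0$. For a stochastic process $v$ put $\|v\|_{2,e}^2=\sum_{k=0}^\infty\mathbf E[\|v(k)\|^2]$. The system is *uniformly mean square strictly contractive* if there is $\gamma\in(0,1)$ such that, when $x(0)=0$, $\|z\|_{2,e}\le\gamma\|w\|_{2,e}$ for every $\psi\in\Psi$ and every $\mathbb R^m$-valued stochastic process $w$ with $\|w\|_{2,e}<\infty$ that does not anticipate the chain, i.e. such that for every $k\in\mathbb N_0$ the family $(w(0),\dots,w(k))$ and $\theta(k+1)$ are conditionally independent given $(\theta(0),\dots,\theta(k))$. For $M\in\mathbb N_0$ let $\Psi_M=\{(\psi(t+1),\dots,\psi(t+M)):\psi\in\Psi,\ t\in\mathbb N_0\}\subseteq\mathcal J^M$. For $i\in\mathcal N$ and symmetric $X,Y\in\mathbb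 R^{n\times n}$ let $$\mathcal B(i,X,Y)=\begin{bmatrix}A(i)&B(i)\\C(i)&D(i)\end{bmatrix}^{T}\begin{bmatrix}X&0\\0&I\end{bmatrix}\begin{bmatrix}A(i)&B(i)\\C(i)&D(i)\end{bmatrix}-\begin{bmatrix}Y&0\\0&I\end{bmatrix}.$$ **Theorem.** Assume $\mathbf P\{\theta_\psi(k)=i\}>0$ for all $\psi\in\Psi$, $i\in\mathcal N$ and $k\in\mathbb N_0$. Then the switched Markov jump linear system is uniformly exponentially mean square stable and uniformly mean square strictly contractive if and only if there exist $M\in\mathbb N_0$ and a function $X$ from $\mathcal N\times\Psi_M$ to the positive definite symmetric $n\times n$ matrices such that, for all $(r_1,\dots,r_{M+1})\in\Psi_{M+1}$ and all $i\in\mathcal N$, $$\mathcal B\Big(i,\ \sum_{j=1}^N\pi_{ij}(r_1)\,X(j,r_2,\dots,r_{M+1}),\ X(i,r_1,\dots,r_M)\Big)<0 .$$ -/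

import Mathlib

open MeasureTheory ProbabilityTheory
open scoped Matrix ENNReal

/-- A switched Markov jump linear system `(𝒢, Π, Ψ, p(0))` with `N` modes, `J` transition
probability matrices, state dimension `n`, disturbance dimension `m` and error dimension `p`.

Switching sequences `ψ(1), ψ(2), …` are stored with indices starting at `0`: the entry `ψ k` of
the Lean sequence is the index `ψ(k+1)` of the transition probability matrix that governs the
step from `θ(k)` to `θ(k+1)`. -/
structure SMJLS (n m p N J : ℕ) where
  /-- the matrices `A(i)` -/
  A : Fin N → Matrix (Fin n) (Fin n) ℝ
  /-- the matrices `B(i)` -/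
  B : Fin N → Matrix (Fin n) (Fin m) ℝ
  /-- the matrices `C(i)` -/
  C : Fin N → Matrix (Fin p) (Fin n) ℝ
  /-- the matrices `D(i)` -/
  D : Fin N → Matrix (Fin p) (Fin m) ℝ
  /-- the transition probability matrices `Π(s)` -/
  trans : Fin J → Matrix (Fin N) (Fin N) ℝ
  /-- every `Π(s)` is a stochastic matrix: nonnegative entries and row sums one -/
  trans_mem : ∀ s, trans s ∈ Matrix.rowStochastic ℝ (Fin N)
  /-- the set `Ψ` of admissible switching sequences -/
  Psi : Set (ℕ → Fin J)
  /-- the initial distribution `p(0)` -/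
  p0 : Fin N → ℝ
  /-- `p(0)` is a probability vector -/
  p0_mem : p0 ∈ stdSimplex ℝ (Fin N)

/-- `θ` is a Markov chain on `(Ω, P)` with values in `{1, …, N}`, initial distribution `p0`, and
transition probability matrix `T k` for the step from time `k` to time `k + 1`:
`P(θ(0) = i) = p0 i`, and
`P(θ(0) = h 0, …, θ(k+1) = h (k+1)) = T k (h k) (h (k+1)) * P(θ(0) = h 0, …, θ(k) = h k)`. -/
structure IsMarkovChain {Ω : Type*} [MeasurableSpace Ω] (P : Measure Ω) {N : ℕ}
    (T : ℕ → Matrix (Fin N) (Fin N) ℝ) (p0 : Fin N → ℝ) (θ : ℕ → Ω → Fin N) : Prop where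
  measurable : ∀ k, Measurable (θ k)
  init : ∀ i, P.real {ω | θ 0 ω = i} = p0 i
  step : ∀ (k : ℕ) (h : ℕ → Fin N),
    P.real {ω | ∀ l ≤ k + 1, θ l ω = h l} =
      T k (h k) (h (k + 1)) * P.real {ω | ∀ l ≤ k, θ l ω = h l}

/-- The mean square norm `‖w‖_{2,e} = (∑_{k ≥ 0} E[‖w(k)‖²])^{1/2}`, with values in `[0, ∞]`. -/
noncomputable def l2eNorm {Ω : Type*} [MeasurableSpace Ω] (P : Measure Ω) {q : ℕ}
    (w : ℕ → Ω → EuclideanSpace ℝ (Fin q)) : ℝ≥0∞ :=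
  (∑' k : ℕ, ∫⁻ ω, ‖w k ω‖ₑ ^ 2 ∂P) ^ (1 / 2 : ℝ)

/-- `w` does not anticipate the chain `θ`: for every `k`, the variables `w(0), …, w(k)` and
`θ(k+1)` are conditionally independent given `θ(0), …, θ(k)`. Conditioning on these finitely
valued variables is conditioning on each of the events `θ(0) = h 0, …, θ(k) = h k`; for an event
of probability zero the conditional measure is `0` and the condition is void. -/
def Nonanticipative {Ω : Type*} [MeasurableSpace Ω] (P : Measure Ω) {N q : ℕ}
    (θ : ℕ → Ω → Fin N) (w : ℕ → Ω → EuclideanSpace ℝ (Fin q)) : Prop :=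
  ∀ (k : ℕ) (h : ℕ → Fin N),
    IndepFun (fun ω (l : Fin (k + 1)) => w l ω) (θ (k + 1))
      (ProbabilityTheory.cond P {ω | ∀ l ≤ k, θ l ω = h l})

/-- The disturbances in `ℓ²_e` for a system driven by the chain `θ`: mean square summable
stochastic processes that do not anticipate the chain. -/
structure IsDisturbance {Ω : Type*} [MeasurableSpace Ω] (P : Measure Ω) {N q : ℕ}
    (θ : ℕ → Ω → Fin N) (w : ℕ → Ω → EuclideanSpace ℝ (Fin q)) : Prop where
  measurable : ∀ k, Measurable (w k)
  finite : l2eNorm P w < ∞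
  nonanticipative : Nonanticipative P θ w

namespace SMJLS

variable {n m p N J : ℕ}

/-- The state transition matrix `Φ(k, j) = A(h (k-1)) ⋯ A(h j)` along a mode path `h`, for
`j ≤ k` (in particular `Φ(j, j) = 1`); the values for `k < j` are never used. -/
def Phi (S : SMJLS n m p N J) (h : ℕ → Fin N) (j : ℕ) : ℕ → Matrix (Fin n) (Fin n) ℝ
  | 0 => 1
  | k + 1 => if j ≤ k then S.A (h k) * Phi S h j k else 1

/-- The state `x(k)` along a mode path `h` with disturbance path `u`, for `x(0) = 0`. -/
def state (S : SMJLS n m p N J) (h : ℕ → Fin N) (u : ℕ → EuclideanSpace ℝ (Fin m)) :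
    ℕ → (Fin n → ℝ)
  | 0 => 0
  | k + 1 => S.A (h k) *ᵥ state S h u k + S.B (h k) *ᵥ (u k).ofLp

/-- The error `z(k) = C(θ(k)) x(k) + D(θ(k)) w(k)` for `x(0) = 0`, as a stochastic process. -/
def error (S : SMJLS n m p N J) {Ω : Type*} (θ : ℕ → Ω → Fin N)
    (w : ℕ → Ω → EuclideanSpace ℝ (Fin m)) (k : ℕ) (ω : Ω) : EuclideanSpace ℝ (Fin p) :=
  WithLp.toLp 2
    (S.C (θ k ω) *ᵥ S.state (fun l => θ l ω) (fun l => w l ω) k + S.D (θ k ω) *ᵥ (w k ω).ofLp)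

/-- The matrix `E[Φᵀ(k, j) Φ(k, j) | θ(j) = i]` (entrywise expectation under the conditional
probability measure). -/
noncomputable def condGram (S : SMJLS n m p N J) {Ω : Type*} [MeasurableSpace Ω]
    (P : Measure Ω) (θ : ℕ → Ω → Fin N) (k j : ℕ) (i : Fin N) : Matrix (Fin n) (Fin n) ℝ :=
  Matrix.of fun a b =>
    ∫ ω, ((S.Phi (fun l => θ l ω) j k)ᵀ * S.Phi (fun l => θ l ω) j k) a b
      ∂(ProbabilityTheory.cond P {ω | θ j ω = i})

/-- Uniform exponential mean square stability, where `θ ψ` is the chain that drives the member of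
the system with switching sequence `ψ`. -/
def UniformlyExpMeanSquareStable (S : SMJLS n m p N J) {Ω : Type*} [MeasurableSpace Ω]
    (P : Measure Ω) (θ : (ℕ → Fin J) → ℕ → Ω → Fin N) : Prop :=
  ∃ c lam : ℝ, 1 ≤ c ∧ 0 ≤ lam ∧ lam < 1 ∧
    ∀ ψ ∈ S.Psi, ∀ (i : Fin N) (k j : ℕ), j ≤ k →
      ((c * lam ^ (k - j)) • (1 : Matrix (Fin n) (Fin n) ℝ) -
        S.condGram P (θ ψ) k j i).PosSemidef

/-- Uniform mean square strict contractiveness, where `θ ψ` is the chain that drives the member of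
the system with switching sequence `ψ`. -/
def UniformlyMeanSquareStrictlyContractive (S : SMJLS n m p N J) {Ω : Type*}
    [MeasurableSpace Ω] (P : Measure Ω) (θ : (ℕ → Fin J) → ℕ → Ω → Fin N) : Prop :=
  ∃ γ : ℝ, 0 < γ ∧ γ < 1 ∧
    ∀ ψ ∈ S.Psi, ∀ w : ℕ → Ω → EuclideanSpace ℝ (Fin m), IsDisturbance P (θ ψ) w →
      l2eNorm P (S.error (θ ψ) w) ≤ ENNReal.ofReal γ * l2eNorm P w

/-- The set `Ψ_M` of all windows of length `M` that occur in an admissible switching sequence. -/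
def windows (S : SMJLS n m p N J) (M : ℕ) : Set (Fin M → Fin J) :=
  {r | ∃ ψ ∈ S.Psi, ∃ t : ℕ, r = fun l : Fin M => ψ (t + l)}

/-- The first `M` entries `(r_1, …, r_M)` of a window `(r_1, …, r_{M+1})`. -/
def initWindow (S : SMJLS n m p N J) {M : ℕ} (r : S.windows (M + 1)) : S.windows M :=
  ⟨fun l => r.1 l.castSucc, by
    obtain ⟨r, ψ, hψ, t, rfl⟩ := r
    exact ⟨ψ, hψ, t, rfl⟩⟩

/-- The last `M` entries `(r_2, …, r_{M+1})` of a window `(r_1, …, r_{M+1})`. -/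
def tailWindow (S : SMJLS n m p N J) {M : ℕ} (r : S.windows (M + 1)) : S.windows M :=
  ⟨fun l => r.1 l.succ, by
    obtain ⟨r, ψ, hψ, t, rfl⟩ := r
    refine ⟨ψ, hψ, t + 1, ?_⟩
    funext l
    simp only [Fin.val_succ]
    congr 1
    omega⟩

/-- The matrix `ℬ(i, X, Y)` of the bounded real inequality. -/
def brl (S : SMJLS n m p N J) (i : Fin N) (X Y : Matrix (Fin n) (Fin n) ℝ) :
    Matrix (Fin n ⊕ Fin m) (Fin n ⊕ Fin m) ℝ :=
  (Matrix.fromBlocks (S.A i) (S.B i) (S.C i) (S.D i))ᵀ *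
      Matrix.fromBlocks X 0 0 (1 : Matrix (Fin p) (Fin p) ℝ) *
      Matrix.fromBlocks (S.A i) (S.B i) (S.C i) (S.D i) -
    Matrix.fromBlocks Y 0 0 (1 : Matrix (Fin m) (Fin m) ℝ)

end SMJLS

/-! Both directions rest on storage functions: quadratic forms in the state, depending on the mode
and on finitely many upcoming switching indices, whose mean over the next mode plus the output
energy is at most the present form plus the input energy, with a strict margin.

From inequality to system. Evaluating `X` on the window that starts at time `k` gives a storage
function along each `ψ`. Since `𝒩 × Ψ_M` is finite, the margin `ε` and the bounds `α`, `β` on the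
forms are uniform. A nonanticipative input leaves the conditional law of the next mode unchanged
(`integral_quad_next`), so the pointwise inequality survives taking expectations. Summing it from
`x(0) = 0` gives contractivity with `γ² = 1 - ε`; with zero input the stored energy shrinks by the
factor `1 - ε/β` per step, which is stability with `c = β/α`.

From system to inequality. Consider the `k`-step problem of maximizing the expected output energy
minus `1 - ε` times the input energy. Its value follows a backward Riccati recursion that uses only
the next `k` switching indices. To see that the recursion is well posed and uniformly bounded, start
at time `t` in mode `i` from state `x₀` with input `u₀`, and apply the optimal feedback afterwards
(`stepCost_value_le`). The output is the zero-state response to this input, controlled by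
contractivity, plus a free response, controlled by stability. Division by `P(θ(t) = i) > 0` gives a
deterministic bound. A small multiple of the truncated Lyapunov sum is added to make the forms
positive definite and the margin strict in the state as well.

The resulting forms `V k` are not yet storage functions: their inequality relates horizon `k` after
the step to horizon `k + 1` before it. Averaging over `k < M` repairs this without any limit
(`FiniteHorizonStorage.exists_brl`): the mismatch telescopes to `(V M - V 0)/M ≤ C/M`, which the
margin `μ` absorbs once `μ M > C`. The average sees only finitely many indices, hence is a function
on `Ψ_M`. -/

/-! ### Quadratic forms of real matrices -/

section QuadraticForms

variable {ι κ : Type*} [Fintype ι] [Fintype κ]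

/-- The quadratic form `xᵀ Z x`. -/
def quad (Z : Matrix ι ι ℝ) (x : ι → ℝ) : ℝ := x ⬝ᵥ Z *ᵥ x

theorem quad_add (Z W : Matrix ι ι ℝ) (x : ι → ℝ) : quad (Z + W) x = quad Z x + quad W x := by
  simp [quad, Matrix.add_mulVec, dotProduct_add]

theorem quad_sub (Z W : Matrix ι ι ℝ) (x : ι → ℝ) : quad (Z - W) x = quad Z x - quad W x := by
  simp [quad, Matrix.sub_mulVec, dotProduct_sub]

theorem quad_neg (Z : Matrix ι ι ℝ) (x : ι → ℝ) : quad (-Z) x = -quad Z x := by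
  simp [quad, Matrix.neg_mulVec, dotProduct_neg]

theorem quad_smul (c : ℝ) (Z : Matrix ι ι ℝ) (x : ι → ℝ) : quad (c • Z) x = c * quad Z x := by
  simp [quad, Matrix.smul_mulVec, dotProduct_smul]

@[simp] theorem quad_zero (x : ι → ℝ) : quad 0 x = 0 := by
  simp [quad]

@[simp] theorem quad_zero_vec (Z : Matrix ι ι ℝ) : quad Z 0 = 0 := by
  simp [quad]

theorem quad_one [DecidableEq ι] (x : ι → ℝ) : quad 1 x = x ⬝ᵥ x := by
  simp [quad]

theorem quad_sum {α : Type*} (s : Finset α) (Z : α → Matrix ι ι ℝ) (x : ι → ℝ) :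
    quad (∑ a ∈ s, Z a) x = ∑ a ∈ s, quad (Z a) x := by
  classical
  induction s using Finset.induction_on with
  | empty => simp
  | insert a s ha ih => rw [Finset.sum_insert ha, Finset.sum_insert ha, quad_add, ih]

theorem quad_smul_vec (Z : Matrix ι ι ℝ) (c : ℝ) (x : ι → ℝ) :
    quad Z (c • x) = c ^ 2 * quad Z x := by
  simp only [quad, Matrix.mulVec_smul, dotProduct_smul, smul_dotProduct, smul_eq_mul]
  ring

theorem dotProduct_mulVec_transpose (A : Matrix ι κ ℝ) (x : κ → ℝ) (y : ι → ℝ) :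
    x ⬝ᵥ Aᵀ *ᵥ y = (A *ᵥ x) ⬝ᵥ y := by
  rw [Matrix.mulVec_transpose, dotProduct_comm, ← Matrix.dotProduct_mulVec, dotProduct_comm]

theorem quad_conj (Z : Matrix ι ι ℝ) (A : Matrix ι κ ℝ) (x : κ → ℝ) :
    quad (Aᵀ * Z * A) x = quad Z (A *ᵥ x) := by
  rw [quad, ← Matrix.mulVec_mulVec, ← Matrix.mulVec_mulVec, dotProduct_mulVec_transpose, quad]

theorem quad_transpose_mul (A : Matrix ι κ ℝ) (x : κ → ℝ) :
    quad (Aᵀ * A) x = (A *ᵥ x) ⬝ᵥ (A *ᵥ x) := by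
  rw [quad, ← Matrix.mulVec_mulVec, dotProduct_mulVec_transpose]

theorem dotProduct_mulVec_symm {Z : Matrix ι ι ℝ} (hZ : Z.IsSymm) (x y : ι → ℝ) :
    x ⬝ᵥ Z *ᵥ y = y ⬝ᵥ Z *ᵥ x := by
  conv_lhs => rw [← hZ.eq]
  rw [dotProduct_mulVec_transpose, dotProduct_comm]

theorem quad_add_vec {Z : Matrix ι ι ℝ} (hZ : Z.IsSymm) (x y : ι → ℝ) :
    quad Z (x + y) = quad Z x + quad Z y + 2 * (x ⬝ᵥ Z *ᵥ y) := by
  simp only [quad, Matrix.mulVec_add, dotProduct_add, add_dotProduct]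
  rw [dotProduct_mulVec_symm hZ y x]
  ring

/-- Young's inequality, obtained by expanding the nonnegative form at `η x - y` and dividing by `η`.
-/
theorem quad_add_vec_le {Z : Matrix ι ι ℝ} (hZ : Z.IsSymm) (hpos : ∀ x, 0 ≤ quad Z x) {η : ℝ}
    (hη : 0 < η) (x y : ι → ℝ) :
    quad Z (x + y) ≤ (1 + η) * quad Z x + (1 + 1 / η) * quad Z y := by
  have h := hpos (η • x + (-1 : ℝ) • y)
  rw [quad_add_vec hZ, quad_smul_vec, quad_smul_vec, Matrix.mulVec_smul, dotProduct_smul,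
    smul_dotProduct] at h
  rw [quad_add_vec hZ]
  simp only [smul_eq_mul] at h
  have h2 : 2 * (x ⬝ᵥ Z *ᵥ y) ≤ η * quad Z x + 1 / η * quad Z y := by
    have : 0 ≤ (1 / η) * (η ^ 2 * quad Z x + (-1) ^ 2 * quad Z y
        + 2 * (-1 * (η * (x ⬝ᵥ Z *ᵥ y)))) := mul_nonneg (by positivity) h
    have e : (1 / η) * (η ^ 2 * quad Z x + (-1) ^ 2 * quad Z y
        + 2 * (-1 * (η * (x ⬝ᵥ Z *ᵥ y)))) = η * quad Z x + 1 / η * quad Z y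
          - 2 * (x ⬝ᵥ Z *ᵥ y) := by
      field_simp
      ring
    linarith
  linarith

theorem dotProduct_self_nonneg_real (x : ι → ℝ) : 0 ≤ x ⬝ᵥ x :=
  Finset.sum_nonneg fun _ _ => mul_self_nonneg _

theorem dotProduct_self_pos_real {x : ι → ℝ} (hx : x ≠ 0) : 0 < x ⬝ᵥ x := by
  refine lt_of_le_of_ne (dotProduct_self_nonneg_real x) fun h => hx ?_
  exact dotProduct_self_eq_zero.1 h.symm

theorem dotProduct_add_self_le {η : ℝ} (hη : 0 < η) (x y : ι → ℝ) :
    (x + y) ⬝ᵥ (x + y) ≤ (1 + η) * (x ⬝ᵥ x) + (1 + 1 / η) * (y ⬝ᵥ y) := by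
  classical
  have h := quad_add_vec_le (Matrix.isSymm_one (n := ι) (α := ℝ))
    (fun x => by rw [quad_one]; exact dotProduct_self_nonneg_real x) hη x y
  simpa only [quad_one] using h

theorem abs_quad_le (Z : Matrix ι ι ℝ) (x : ι → ℝ) :
    |quad Z x| ≤ (∑ a, ∑ b, |Z a b|) * (x ⬝ᵥ x) := by
  have hle : ∀ a, x a * x a ≤ x ⬝ᵥ x := fun a =>
    Finset.single_le_sum (f := fun a => x a * x a) (fun _ _ => mul_self_nonneg _)
      (Finset.mem_univ a)
  rw [quad, dotProduct, Finset.sum_mul]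
  refine (Finset.abs_sum_le_sum_abs _ _).trans (Finset.sum_le_sum fun a _ => ?_)
  rw [Matrix.mulVec, dotProduct, Finset.mul_sum, Finset.sum_mul]
  refine (Finset.abs_sum_le_sum_abs _ _).trans (Finset.sum_le_sum fun b _ => ?_)
  have h1 : |x a * x b| ≤ x ⬝ᵥ x := by
    have := hle a
    have := hle b
    rw [abs_le]
    constructor <;> nlinarith [sq_nonneg (x a + x b), sq_nonneg (x a - x b)]
  calc |x a * (Z a b * x b)| = |Z a b| * |x a * x b| := by
        rw [← abs_mul]; congr 1; ring
    _ ≤ _ := mul_le_mul_of_nonneg_left h1 (abs_nonneg _)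

theorem exists_quad_le {α : Type*} [Finite α] (Z : α → Matrix ι ι ℝ) :
    ∃ β : ℝ, 0 < β ∧ ∀ a x, quad (Z a) x ≤ β * (x ⬝ᵥ x) := by
  cases nonempty_fintype α
  have hnn : ∀ a, 0 ≤ ∑ b, ∑ c, |Z a b c| := fun a =>
    Finset.sum_nonneg fun _ _ => Finset.sum_nonneg fun _ _ => abs_nonneg _
  refine ⟨∑ a, (∑ b, ∑ c, |Z a b c|) + 1, ?_, fun a x => ?_⟩
  · have := Finset.sum_nonneg fun a (_ : a ∈ Finset.univ) => hnn a
    linarith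
  · refine (le_abs_self _).trans ((abs_quad_le _ _).trans
      (mul_le_mul_of_nonneg_right ?_ (dotProduct_self_nonneg_real x)))
    have := Finset.single_le_sum (fun a _ => hnn a) (Finset.mem_univ a)
    linarith

theorem exists_mulVec_le {α : Type*} [Finite α] (A : α → Matrix ι κ ℝ) :
    ∃ β : ℝ, 0 < β ∧ ∀ a x, (A a *ᵥ x) ⬝ᵥ (A a *ᵥ x) ≤ β * (x ⬝ᵥ x) := by
  obtain ⟨β, h0, h⟩ := exists_quad_le fun a => (A a)ᵀ * A a
  exact ⟨β, h0, fun a x => by simpa only [quad_transpose_mul] using h a x⟩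

theorem posDef_iff_quad {Z : Matrix ι ι ℝ} :
    Z.PosDef ↔ Z.IsSymm ∧ ∀ x, x ≠ 0 → 0 < quad Z x := by
  rw [Matrix.posDef_iff_dotProduct_mulVec]
  simp [quad, Matrix.IsHermitian, Matrix.IsSymm, Matrix.conjTranspose_eq_transpose_of_trivial]

theorem posSemidef_iff_quad {Z : Matrix ι ι ℝ} :
    Z.PosSemidef ↔ Z.IsSymm ∧ ∀ x, 0 ≤ quad Z x := by
  rw [Matrix.posSemidef_iff_dotProduct_mulVec]
  simp [quad, Matrix.IsHermitian, Matrix.IsSymm, Matrix.conjTranspose_eq_transpose_of_trivial]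

/-- The Rayleigh quotient attains its minimum on a compact sphere and is scale invariant. The norm
of `ι → ℝ` is the sup norm, so the quotient is minimized rather than the form itself. -/
theorem Matrix.PosDef.exists_le_quad {Z : Matrix ι ι ℝ} (hZ : Z.PosDef) :
    ∃ ε : ℝ, 0 < ε ∧ ∀ x, ε * (x ⬝ᵥ x) ≤ quad Z x := by
  have hcont : Continuous fun x : ι → ℝ => quad Z x := by
    unfold quad dotProduct Matrix.mulVec dotProduct
    fun_prop
  have hcont' : Continuous fun x : ι → ℝ => x ⬝ᵥ x := by
    unfold dotProduct
    fun_prop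
  have hpos := (posDef_iff_quad.1 hZ).2
  -- The sphere is empty when `ι` is, and then every vector is zero.
  obtain hE | hE := (Metric.sphere (0 : ι → ℝ) 1).eq_empty_or_nonempty
  · refine ⟨1, one_pos, fun x => ?_⟩
    obtain rfl | hx := eq_or_ne x 0
    · simp
    · exfalso
      have : ‖x‖⁻¹ • x ∈ Metric.sphere (0 : ι → ℝ) 1 := by
        simp [norm_smul, norm_ne_zero_iff.2 hx]
      simp [hE] at this
  · have hne : ∀ x ∈ Metric.sphere (0 : ι → ℝ) 1, x ≠ 0 := by
      rintro x hx rfl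
      simp at hx
    obtain ⟨u, hu, hmin⟩ := (isCompact_sphere (0 : ι → ℝ) 1).exists_isMinOn hE
      (f := fun x => quad Z x / (x ⬝ᵥ x)) (hcont.continuousOn.div hcont'.continuousOn
        fun x hx => (dotProduct_self_pos_real (hne x hx)).ne')
    refine ⟨quad Z u / (u ⬝ᵥ u),
      div_pos (hpos u (hne u hu)) (dotProduct_self_pos_real (hne u hu)), fun x => ?_⟩
    obtain rfl | hx := eq_or_ne x 0
    · simp
    · have hx' := norm_ne_zero_iff.2 hx
      have h := hmin (show ‖x‖⁻¹ • x ∈ Metric.sphere (0 : ι → ℝ) 1 by simp [norm_smul, hx'])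
      have hxx := dotProduct_self_pos_real hx
      simp only [Set.mem_ofPred_eq, quad_smul_vec, dotProduct_smul, smul_dotProduct,
        smul_eq_mul] at h
      have e : ‖x‖⁻¹ ^ 2 * quad Z x / (‖x‖⁻¹ * (‖x‖⁻¹ * (x ⬝ᵥ x))) = quad Z x / (x ⬝ᵥ x) := by
        field_simp
      rw [e, le_div_iff₀ hxx] at h
      exact h

theorem exists_le_quad_of_posDef {α : Type*} [Finite α] (Z : α → Matrix ι ι ℝ)
    (hZ : ∀ a, (Z a).PosDef) : ∃ ε : ℝ, 0 < ε ∧ ∀ a x, ε * (x ⬝ᵥ x) ≤ quad (Z a) x := by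
  cases nonempty_fintype α
  choose e he h using fun a => (hZ a).exists_le_quad
  obtain hα | hα := isEmpty_or_nonempty α
  · exact ⟨1, one_pos, fun a => hα.elim a⟩
  · refine ⟨Finset.univ.inf' Finset.univ_nonempty e, ?_, fun a x => le_trans ?_ (h a x)⟩
    · rw [Finset.lt_inf'_iff]
      exact fun a _ => he a
    · exact mul_le_mul_of_nonneg_right (Finset.inf'_le _ (Finset.mem_univ a))
        (dotProduct_self_nonneg_real x)

end QuadraticForms

/-! ### Means over the next mode and the quadratic form of `ℬ` -/

namespace SMJLS

variable {n m p N J : ℕ} (S : SMJLS n m p N J)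

/-- The mean of the matrices `Z j` under the `i`-th row of the transition matrix `Π(s)`. -/
def meanNext (s : Fin J) (i : Fin N) {q : ℕ} (Z : Fin N → Matrix (Fin q) (Fin q) ℝ) :
    Matrix (Fin q) (Fin q) ℝ :=
  ∑ j, S.trans s i j • Z j

theorem quad_meanNext (s : Fin J) (i : Fin N) {q : ℕ} (Z : Fin N → Matrix (Fin q) (Fin q) ℝ)
    (x : Fin q → ℝ) : quad (S.meanNext s i Z) x = ∑ j, S.trans s i j * quad (Z j) x := by
  simp [meanNext, quad_sum, quad_smul]

theorem trans_nonneg (s : Fin J) (i j : Fin N) : 0 ≤ S.trans s i j :=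
  (Matrix.mem_rowStochastic_iff_sum.1 (S.trans_mem s)).1 i j

theorem sum_trans (s : Fin J) (i : Fin N) : ∑ j, S.trans s i j = 1 :=
  (Matrix.mem_rowStochastic_iff_sum.1 (S.trans_mem s)).2 i

theorem isSymm_meanNext (s : Fin J) (i : Fin N) {q : ℕ} {Z : Fin N → Matrix (Fin q) (Fin q) ℝ}
    (hZ : ∀ j, (Z j).IsSymm) : (S.meanNext s i Z).IsSymm := by
  simp only [Matrix.IsSymm, meanNext, Matrix.transpose_sum, Matrix.transpose_smul]
  exact Finset.sum_congr rfl fun j _ => by rw [(hZ j).eq]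

theorem quad_meanNext_nonneg (s : Fin J) (i : Fin N) {q : ℕ}
    {Z : Fin N → Matrix (Fin q) (Fin q) ℝ} {x : Fin q → ℝ} (hZ : ∀ j, 0 ≤ quad (Z j) x) :
    0 ≤ quad (S.meanNext s i Z) x := by
  rw [quad_meanNext]
  exact Finset.sum_nonneg fun j _ => mul_nonneg (S.trans_nonneg s i j) (hZ j)

theorem quad_meanNext_le (s : Fin J) (i : Fin N) {q : ℕ} {Z : Fin N → Matrix (Fin q) (Fin q) ℝ}
    {x : Fin q → ℝ} {c : ℝ} (hZ : ∀ j, quad (Z j) x ≤ c) : quad (S.meanNext s i Z) x ≤ c := by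
  rw [quad_meanNext]
  calc ∑ j, S.trans s i j * quad (Z j) x ≤ ∑ j, S.trans s i j * c :=
        Finset.sum_le_sum fun j _ => mul_le_mul_of_nonneg_left (hZ j) (S.trans_nonneg s i j)
    _ = c := by rw [← Finset.sum_mul, S.sum_trans, one_mul]

theorem quad_brl (i : Fin N) (X Y : Matrix (Fin n) (Fin n) ℝ) (x : Fin n → ℝ)
    (u : Fin m → ℝ) :
    quad (S.brl i X Y) (Sum.elim x u) = quad X (S.A i *ᵥ x + S.B i *ᵥ u)
      + (S.C i *ᵥ x + S.D i *ᵥ u) ⬝ᵥ (S.C i *ᵥ x + S.D i *ᵥ u) - quad Y x - u ⬝ᵥ u := by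
  rw [brl, quad_sub, quad_conj, Matrix.fromBlocks_mulVec]
  simp only [quad, Matrix.fromBlocks_mulVec, Sum.elim_comp_inl, Sum.elim_comp_inr,
    Matrix.zero_mulVec, Matrix.one_mulVec, add_zero, zero_add, sumElim_dotProduct_sumElim]
  ring

theorem isSymm_brl (i : Fin N) {X Y : Matrix (Fin n) (Fin n) ℝ} (hX : X.IsSymm)
    (hY : Y.IsSymm) : (S.brl i X Y).IsSymm := by
  have h1 : (Matrix.fromBlocks X 0 0 (1 : Matrix (Fin p) (Fin p) ℝ)).IsSymm :=
    hX.fromBlocks (by simp) Matrix.isSymm_one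
  have h2 : (Matrix.fromBlocks Y 0 0 (1 : Matrix (Fin m) (Fin m) ℝ)).IsSymm :=
    hY.fromBlocks (by simp) Matrix.isSymm_one
  rw [Matrix.IsSymm, brl, Matrix.transpose_sub, h2.eq, Matrix.transpose_mul, Matrix.transpose_mul,
    h1.eq, Matrix.transpose_transpose, Matrix.mul_assoc]

end SMJLS

/-! ### Processes adapted to the joint history of the chain and the disturbance -/

section Adapted

variable {Ω : Type*} [mΩ : MeasurableSpace Ω] {P : Measure Ω} {N m q r : ℕ}
  {θ : ℕ → Ω → Fin N} {w : ℕ → Ω → EuclideanSpace ℝ (Fin m)}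

/-- The `σ`-algebra generated by `θ(0), …, θ(k)` and `w(0), …, w(k)`. -/
@[reducible] def history (θ : ℕ → Ω → Fin N) (w : ℕ → Ω → EuclideanSpace ℝ (Fin m)) (k : ℕ) :
    MeasurableSpace Ω :=
  MeasurableSpace.comap
    (fun ω => ((fun l : Fin (k + 1) => θ l ω), (fun l : Fin (k + 1) => w l ω))) inferInstance

theorem history_le (hθ : ∀ k, Measurable (θ k)) (hw : ∀ k, Measurable (w k)) (k : ℕ) :
    history θ w k ≤ mΩ := by
  refine Measurable.comap_le (Measurable.prodMk ?_ ?_)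
  · exact measurable_pi_lambda _ fun l => hθ l
  · exact measurable_pi_lambda _ fun l => hw l

theorem measurable_history (θ : ℕ → Ω → Fin N) (w : ℕ → Ω → EuclideanSpace ℝ (Fin m)) (k : ℕ) :
    Measurable[history θ w k]
      (fun ω => ((fun l : Fin (k + 1) => θ l ω), (fun l : Fin (k + 1) => w l ω))) :=
  comap_measurable _

theorem measurable_history_chain {k l : ℕ} (hl : l ≤ k) : Measurable[history θ w k] (θ l) :=
  ((measurable_pi_apply (⟨l, by omega⟩ : Fin (k + 1))).comp measurable_fst).comp
    (measurable_history θ w k)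

theorem measurable_history_input {k l : ℕ} (hl : l ≤ k) : Measurable[history θ w k] (w l) :=
  ((measurable_pi_apply (⟨l, by omega⟩ : Fin (k + 1))).comp measurable_snd).comp
    (measurable_history θ w k)

theorem history_mono {k l : ℕ} (hl : l ≤ k) : history θ w l ≤ history θ w k := by
  refine Measurable.comap_le (Measurable.prodMk ?_ ?_)
  · exact @measurable_pi_lambda _ _ _ (history θ w k) _ _ fun i =>
      measurable_history_chain (by omega)
  · exact @measurable_pi_lambda _ _ _ (history θ w k) _ _ fun i =>
      measurable_history_input (by omega)

/-- `x` is square integrable and determined by `θ(0), …, θ(k), w(0), …, w(k)`. -/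
structure IsL2Adapted (P : Measure Ω) (θ : ℕ → Ω → Fin N)
    (w : ℕ → Ω → EuclideanSpace ℝ (Fin m)) (k : ℕ) (x : Ω → Fin q → ℝ) : Prop where
  measurable : ∀ a, Measurable[history θ w k] fun ω => x ω a
  memLp : ∀ a, MemLp (fun ω => x ω a) 2 P

namespace IsL2Adapted

variable {k : ℕ} {x y : Ω → Fin q → ℝ}

theorem mono {l : ℕ} (hx : IsL2Adapted P θ w l x) (hl : l ≤ k) : IsL2Adapted P θ w k x :=
  ⟨fun a => (hx.measurable a).mono (history_mono hl) le_rfl, hx.memLp⟩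

theorem add (hx : IsL2Adapted P θ w k x) (hy : IsL2Adapted P θ w k y) :
    IsL2Adapted P θ w k fun ω => x ω + y ω :=
  ⟨fun a => (hx.measurable a).add (hy.measurable a), fun a => (hx.memLp a).add (hy.memLp a)⟩

theorem of_chain [IsFiniteMeasure P] (hθ : ∀ k, Measurable (θ k)) (g : Fin N → Fin q → ℝ) :
    IsL2Adapted P θ w k fun ω => g (θ k ω) := by
  refine ⟨fun a => (Measurable.of_discrete (f := fun i => g i a)).comp
    (measurable_history_chain le_rfl), fun a => ?_⟩
  refine MemLp.of_bound ((Measurable.of_discrete (f := fun i => g i a)).comp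
    (hθ k)).aestronglyMeasurable (∑ i, |g i a|) (Filter.Eventually.of_forall fun ω => ?_)
  exact Finset.single_le_sum (f := fun i => |g i a|) (fun _ _ => abs_nonneg _)
    (Finset.mem_univ (θ k ω))

theorem mulVec (hθ : ∀ k, Measurable (θ k)) (A : Fin N → Matrix (Fin r) (Fin q) ℝ)
    (hx : IsL2Adapted P θ w k x) : IsL2Adapted P θ w k fun ω => A (θ k ω) *ᵥ x ω := by
  refine ⟨fun a => ?_, fun a => ?_⟩
  · simp only [Matrix.mulVec, dotProduct]
    refine Finset.measurable_fun_sum _ fun b _ => Measurable.mul ?_ (hx.measurable b)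
    exact (Measurable.of_discrete (f := fun i => A i a b)).comp (measurable_history_chain le_rfl)
  · simp only [Matrix.mulVec, dotProduct]
    refine memLp_finsetSum _ fun b _ => ?_
    refine (hx.memLp b).of_le_mul (c := ∑ i, |A i a b|) ?_ (Filter.Eventually.of_forall fun ω => ?_)
    · exact ((Measurable.of_discrete (f := fun i => A i a b)).comp
        (hθ k)).aestronglyMeasurable.mul (hx.memLp b).aestronglyMeasurable
    · rw [norm_mul]
      exact mul_le_mul_of_nonneg_right (Finset.single_le_sum (f := fun i => |A i a b|)
        (fun _ _ => abs_nonneg _) (Finset.mem_univ (θ k ω))) (norm_nonneg _)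

theorem mulVec_const (A : Matrix (Fin r) (Fin q) ℝ) (hθ : ∀ k, Measurable (θ k))
    (hx : IsL2Adapted P θ w k x) : IsL2Adapted P θ w k fun ω => A *ᵥ x ω :=
  hx.mulVec hθ fun _ => A

theorem integrable_dotProduct (hx : IsL2Adapted P θ w k x) (hy : IsL2Adapted P θ w k y) :
    Integrable (fun ω => x ω ⬝ᵥ y ω) P :=
  integrable_finsetSum _ fun a _ => (hx.memLp a).integrable_mul (hy.memLp a)

theorem integrable_quad (hθ : ∀ k, Measurable (θ k)) (Z : Fin N → Matrix (Fin q) (Fin q) ℝ)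
    (hx : IsL2Adapted P θ w k x) : Integrable (fun ω => quad (Z (θ k ω)) (x ω)) P :=
  hx.integrable_dotProduct (hx.mulVec hθ Z)

theorem measurable_quad_const (hθ : ∀ k, Measurable (θ k)) (Z : Matrix (Fin q) (Fin q) ℝ)
    (hx : IsL2Adapted P θ w k x) : Measurable[history θ w k] fun ω => quad Z (x ω) := by
  have hZ := hx.mulVec_const Z hθ
  change Measurable[history θ w k] fun ω => ∑ a, x ω a * (Z *ᵥ x ω) a
  exact Finset.measurable_fun_sum _ fun a _ => (hx.measurable a).mul (hZ.measurable a)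

end IsL2Adapted

variable [IsProbabilityMeasure P] {T : ℕ → Matrix (Fin N) (Fin N) ℝ} {p0 : Fin N → ℝ}

/-- The Markov property in the presence of past inputs: on a mode path of positive probability,
conditional independence lets the input event factor out of the transition; on a null path both
sides vanish. -/
theorem real_inter_path_next (hmc : IsMarkovChain P T p0 θ)
    (hna : Nonanticipative P θ w) (k : ℕ) (h : ℕ → Fin N)
    {s : Set (Fin (k + 1) → EuclideanSpace ℝ (Fin m))} (hs : MeasurableSet s) :
    P.real ({ω | ∀ l ≤ k, θ l ω = h l} ∩ (fun ω (l : Fin (k + 1)) => w l ω) ⁻¹' s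
        ∩ {ω | θ (k + 1) ω = h (k + 1)}) =
      T k (h k) (h (k + 1)) * P.real ({ω | ∀ l ≤ k, θ l ω = h l}
        ∩ (fun ω (l : Fin (k + 1)) => w l ω) ⁻¹' s) := by
  set E := {ω | ∀ l ≤ k, θ l ω = h l} with hE
  set W := (fun ω (l : Fin (k + 1)) => w l ω) ⁻¹' s
  have hEm : MeasurableSet E := by
    have : E = ⋂ l, ⋂ (_ : l ≤ k), θ l ⁻¹' {h l} := by
      ext ω; simp [hE]
    rw [this]
    exact MeasurableSet.iInter fun l => MeasurableSet.iInter fun _ =>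
      hmc.measurable l (measurableSet_singleton _)
  have hstep : P.real (E ∩ {ω | θ (k + 1) ω = h (k + 1)}) =
      T k (h k) (h (k + 1)) * P.real E := by
    rw [hE, ← hmc.step k h]
    congr 1
    ext ω
    simp only [Set.mem_inter_iff, Set.mem_ofPred_eq]
    constructor
    · rintro ⟨h1, h2⟩ l hl
      obtain hl' | rfl := Nat.le_succ_iff.1 hl
      · exact h1 l hl'
      · exact h2
    · exact fun h1 => ⟨fun l hl => h1 l (by omega), h1 _ le_rfl⟩
  have hind := (hna k h).meas_inter (s := W) (t := {ω | θ (k + 1) ω = h (k + 1)})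
    ⟨s, hs, rfl⟩ ⟨{h (k + 1)}, measurableSet_singleton _, rfl⟩
  rw [cond_apply hEm, cond_apply hEm, cond_apply hEm, ← Set.inter_assoc] at hind
  have hind' := congrArg ENNReal.toReal hind
  simp only [ENNReal.toReal_mul, ENNReal.toReal_inv, ← Measure.real_def] at hind'
  by_cases h0 : P.real E = 0
  · have hz : ∀ A : Set Ω, A ⊆ E → P.real A = 0 := fun A hA =>
      le_antisymm ((measureReal_mono hA).trans h0.le) measureReal_nonneg
    rw [hz _ (Set.inter_subset_left.trans Set.inter_subset_left), hz _ Set.inter_subset_left,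
      mul_zero]
  · rw [hstep] at hind'
    field_simp at hind'
    linarith

theorem setIntegral_next (hmc : IsMarkovChain P T p0 θ) (hw : ∀ k, Measurable (w k))
    (hna : Nonanticipative P θ w) (k : ℕ) (j : Fin N) {s : Set Ω}
    (hs : MeasurableSet[history θ w k] s) :
    ∫ ω in s, T k (θ k ω) j ∂P = P.real (s ∩ {ω | θ (k + 1) ω = j}) := by
  have hsm : MeasurableSet s := history_le hmc.measurable hw k s hs
  obtain ⟨S, hS, rfl⟩ := hs
  set s := (fun ω => ((fun l : Fin (k + 1) => θ l ω), (fun l : Fin (k + 1) => w l ω))) ⁻¹' S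
    with hsdef
  -- The default value `j` makes the extended path take the value `j` at time `k + 1`, which is the
  -- transition to be measured.
  let ext : (Fin (k + 1) → Fin N) → ℕ → Fin N := fun h l =>
    if hl : l < k + 1 then h ⟨l, hl⟩ else j
  have hext : ∀ h, ext h (k + 1) = j := fun h => by simp [ext]
  let E : (Fin (k + 1) → Fin N) → Set Ω := fun h => {ω | (fun l : Fin (k + 1) => θ l ω) = h}
  have hEm : ∀ h, MeasurableSet (E h) := fun h =>
    (measurable_pi_lambda _ fun l : Fin (k + 1) => hmc.measurable l) (measurableSet_singleton h)
  have hE : ∀ h, E h = {ω | ∀ l ≤ k, θ l ω = ext h l} := by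
    intro h
    ext ω
    simp only [E, ext, Set.mem_ofPred_eq, funext_iff]
    constructor
    · intro H l hl
      rw [dif_pos (Nat.lt_succ_of_le hl)]
      exact H ⟨l, Nat.lt_succ_of_le hl⟩
    · intro H l
      have := H l (by omega)
      rwa [dif_pos l.2] at this
  have hdisj : Pairwise (Function.onFun Disjoint fun h => s ∩ E h) := by
    intro h h' hne
    refine Set.disjoint_left.2 fun ω h1 h2 => hne ?_
    exact h1.2.symm.trans h2.2
  have hunion : s = ⋃ h, s ∩ E h := by
    ext ω
    simp [E]
  have key : ∀ h, P.real (s ∩ E h ∩ {ω | θ (k + 1) ω = j}) =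
      T k (ext h k) j * P.real (s ∩ E h) := by
    intro h
    have hm : MeasurableSet {u | (h, u) ∈ S} := measurable_prodMk_left hS
    have := real_inter_path_next hmc hna k (ext h) hm
    rw [← hE, hext] at this
    have hset : s ∩ E h = E h ∩ (fun ω (l : Fin (k + 1)) => w l ω) ⁻¹' {u | (h, u) ∈ S} := by
      ext ω
      simp only [hsdef, E, Set.mem_inter_iff, Set.mem_preimage, Set.mem_ofPred_eq]
      constructor
      · rintro ⟨h1, h2⟩
        exact ⟨h2, by rw [← h2]; exact h1⟩
      · rintro ⟨h1, h2⟩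
        exact ⟨by rw [h1]; exact h2, h1⟩
    rw [hset]
    exact this
  have hint : Integrable (fun ω => T k (θ k ω) j) P := by
    refine Integrable.of_bound ((Measurable.of_discrete (f := fun i => T k i j)).comp
      (hmc.measurable k)).aestronglyMeasurable (∑ i, |T k i j|)
      (Filter.Eventually.of_forall fun ω => ?_)
    exact Finset.single_le_sum (f := fun i => |T k i j|) (fun _ _ => abs_nonneg _)
      (Finset.mem_univ (θ k ω))
  have hjm : MeasurableSet {ω | θ (k + 1) ω = j} :=
    hmc.measurable (k + 1) (measurableSet_singleton j)
  have hright : P.real (s ∩ {ω | θ (k + 1) ω = j}) =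
      ∑ h, P.real (s ∩ E h ∩ {ω | θ (k + 1) ω = j}) := by
    conv_lhs => rw [hunion, Set.iUnion_inter]
    refine measureReal_iUnion_fintype (fun h h' hne => ?_)
      fun h => (hsm.inter (hEm h)).inter hjm
    exact (hdisj hne).mono Set.inter_subset_left Set.inter_subset_left
  rw [hright]
  conv_lhs => rw [hunion]
  rw [integral_iUnion_fintype (fun h => hsm.inter (hEm h)) hdisj fun h => hint.integrableOn]
  refine Finset.sum_congr rfl fun h _ => ?_
  rw [key, setIntegral_congr_fun (g := fun _ => T k (ext h k) j) (hsm.inter (hEm h)),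
    setIntegral_const, smul_eq_mul, mul_comm]
  intro ω hω
  have : ω ∈ {ω | ∀ l ≤ k, θ l ω = ext h l} := hE h ▸ hω.2
  simp only [this k le_rfl]

/-- By `setIntegral_next`, `T k (θ k) j` is the conditional expectation of the indicator of `θ (k+1)
= j` given the joint history; the factor `g` is pulled out. -/
theorem integral_indicator_next (hmc : IsMarkovChain P T p0 θ) (hw : ∀ k, Measurable (w k))
    (hna : Nonanticipative P θ w) (k : ℕ) (j : Fin N) {g : Ω → ℝ}
    (hg : Measurable[history θ w k] g) (hgi : Integrable g P) :
    ∫ ω, g ω * {ω | θ (k + 1) ω = j}.indicator (fun _ => (1 : ℝ)) ω ∂P =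
      ∫ ω, g ω * T k (θ k ω) j ∂P := by
  have hle := history_le hmc.measurable hw k
  have hjm : MeasurableSet {ω | θ (k + 1) ω = j} :=
    hmc.measurable (k + 1) (measurableSet_singleton j)
  set I : Ω → ℝ := {ω | θ (k + 1) ω = j}.indicator (fun _ => (1 : ℝ))
  have hI : Integrable I P := (integrable_const 1).indicator hjm
  have hTm : Measurable[history θ w k] fun ω => T k (θ k ω) j :=
    (Measurable.of_discrete (f := fun i => T k i j)).comp (measurable_history_chain le_rfl)
  have hT : Integrable (fun ω => T k (θ k ω) j) P := by
    refine Integrable.of_bound (hTm.mono hle le_rfl).aestronglyMeasurable (∑ i, |T k i j|)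
      (Filter.Eventually.of_forall fun ω => ?_)
    exact Finset.single_le_sum (f := fun i => |T k i j|) (fun _ _ => abs_nonneg _)
      (Finset.mem_univ (θ k ω))
  have hcond : (fun ω => T k (θ k ω) j) =ᵐ[P] P[I | history θ w k] := by
    refine ae_eq_condExp_of_forall_setIntegral_eq hle hI (fun s _ _ => hT.integrableOn)
      (fun s hs _ => ?_) hTm.stronglyMeasurable.aestronglyMeasurable
    rw [setIntegral_next hmc hw hna k j hs, setIntegral_indicator hjm, setIntegral_const,
      smul_eq_mul, mul_one]
  have hgI : Integrable (g * I) P := by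
    refine hgi.mul_bdd (c := 1) hI.aestronglyMeasurable (Filter.Eventually.of_forall fun ω => ?_)
    by_cases hω : ω ∈ {ω | θ (k + 1) ω = j} <;> simp [I, hω]
  have h1 := condExp_mul_of_stronglyMeasurable_left hg.stronglyMeasurable hgI hI
  calc ∫ ω, g ω * I ω ∂P = ∫ ω, (P[g * I | history θ w k]) ω ∂P := (integral_condExp hle).symm
    _ = ∫ ω, g ω * T k (θ k ω) j ∂P := by
      refine integral_congr_ae ?_
      filter_upwards [h1, hcond] with ω h2 h3
      rw [h2, Pi.mul_apply, h3]

/-- The only gateway from the chain to the matrix recursions: a form indexed by the next mode may be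
replaced by its transition mean when its argument is known at time `k`. It follows by splitting over
the value of the next mode. -/
theorem integral_quad_next (hmc : IsMarkovChain P T p0 θ) (hw : ∀ k, Measurable (w k))
    (hna : Nonanticipative P θ w) {k : ℕ} {x : Ω → Fin q → ℝ} (hx : IsL2Adapted P θ w k x)
    (Z : Fin N → Matrix (Fin q) (Fin q) ℝ) :
    ∫ ω, quad (Z (θ (k + 1) ω)) (x ω) ∂P =
      ∫ ω, quad (∑ j, T k (θ k ω) j • Z j) (x ω) ∂P := by
  have hθ := hmc.measurable
  have hint : ∀ j, Integrable (fun ω => quad (Z j) (x ω)) P := fun j =>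
    hx.integrable_quad hθ fun _ => Z j
  have hjm : ∀ j, MeasurableSet {ω | θ (k + 1) ω = j} := fun j =>
    hmc.measurable (k + 1) (measurableSet_singleton j)
  have e1 : ∀ ω, quad (Z (θ (k + 1) ω)) (x ω) = ∑ j, quad (Z j) (x ω) *
      {ω | θ (k + 1) ω = j}.indicator (fun _ => (1 : ℝ)) ω := by
    intro ω
    rw [Finset.sum_eq_single (θ (k + 1) ω)]
    · simp
    · intro j _ hj
      simp [Set.indicator, hj.symm]
    · simp
  have e2 : ∀ ω, quad (∑ j, T k (θ k ω) j • Z j) (x ω) =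
      ∑ j, quad (Z j) (x ω) * T k (θ k ω) j := by
    intro ω
    simp only [quad_sum, quad_smul, mul_comm]
  simp only [e1, e2]
  rw [integral_finsetSum, integral_finsetSum]
  · exact Finset.sum_congr rfl fun j _ => integral_indicator_next hmc hw hna k j
      (hx.measurable_quad_const hθ (Z j)) (hint j)
  · intro j _
    refine (hint j).mul_bdd (c := ∑ i, |T k i j|)
      ((Measurable.of_discrete (f := fun i => T k i j)).comp (hθ k)).aestronglyMeasurable
      (Filter.Eventually.of_forall fun ω => ?_)
    exact Finset.single_le_sum (f := fun i => |T k i j|) (fun _ _ => abs_nonneg _)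
      (Finset.mem_univ (θ k ω))
  · intro j _
    refine (hint j).mul_bdd (c := 1)
      (measurable_const.indicator (hjm j)).aestronglyMeasurable
      (Filter.Eventually.of_forall fun ω => ?_)
    by_cases hω : ω ∈ {ω | θ (k + 1) ω = j} <;> simp [hω]

end Adapted

/-! ### The mean square norm -/

section MeanSquareNorm

variable {Ω : Type*} [mΩ : MeasurableSpace Ω] {P : Measure Ω} {N m q r : ℕ}
  {θ : ℕ → Ω → Fin N}

theorem enorm_sq_eq_ofReal_dotProduct (v : EuclideanSpace ℝ (Fin q)) :
    ‖v‖ₑ ^ 2 = ENNReal.ofReal (v.ofLp ⬝ᵥ v.ofLp) := by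
  rw [← ofReal_norm, ← ENNReal.ofReal_pow (norm_nonneg _), EuclideanSpace.real_norm_sq_eq]
  congr 1
  exact Finset.sum_congr rfl fun a _ => by rw [sq]

theorem lintegral_enorm_sq {v : Ω → EuclideanSpace ℝ (Fin q)}
    (hv : Integrable (fun ω => (v ω).ofLp ⬝ᵥ (v ω).ofLp) P) :
    ∫⁻ ω, ‖v ω‖ₑ ^ 2 ∂P = ENNReal.ofReal (∫ ω, (v ω).ofLp ⬝ᵥ (v ω).ofLp ∂P) := by
  rw [ofReal_integral_eq_lintegral_ofReal hv
    (Filter.Eventually.of_forall fun ω => dotProduct_self_nonneg_real _)]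
  simp only [enorm_sq_eq_ofReal_dotProduct]

theorem l2eNorm_sq (v : ℕ → Ω → EuclideanSpace ℝ (Fin q)) :
    l2eNorm P v ^ 2 = ∑' k, ∫⁻ ω, ‖v k ω‖ₑ ^ 2 ∂P := by
  rw [l2eNorm, ← ENNReal.rpow_natCast, ← ENNReal.rpow_mul]
  norm_num

theorem sum_lintegral_enorm_sq {v : ℕ → Ω → EuclideanSpace ℝ (Fin q)}
    (hv : ∀ k, Integrable (fun ω => (v k ω).ofLp ⬝ᵥ (v k ω).ofLp) P) (L : ℕ) :
    ∑ k ∈ Finset.range L, ∫⁻ ω, ‖v k ω‖ₑ ^ 2 ∂P =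
      ENNReal.ofReal (∑ k ∈ Finset.range L, ∫ ω, (v k ω).ofLp ⬝ᵥ (v k ω).ofLp ∂P) := by
  rw [ENNReal.ofReal_sum_of_nonneg fun k _ =>
    integral_nonneg fun ω => dotProduct_self_nonneg_real _]
  exact Finset.sum_congr rfl fun k _ => lintegral_enorm_sq (hv k)

/-- This and `sum_le_of_l2eNorm_le` translate between the extended norm and real partial sums. Here
the series of `z` is the supremum of its partial sums; there the input vanishes from time `L` on, so
its series is a finite sum. -/
theorem l2eNorm_le_mul {z : ℕ → Ω → EuclideanSpace ℝ (Fin q)}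
    {w : ℕ → Ω → EuclideanSpace ℝ (Fin r)}
    (hz : ∀ k, Integrable (fun ω => (z k ω).ofLp ⬝ᵥ (z k ω).ofLp) P)
    (hw : ∀ k, Integrable (fun ω => (w k ω).ofLp ⬝ᵥ (w k ω).ofLp) P) {c : ℝ} (hc : 0 ≤ c)
    (h : ∀ L, ∑ k ∈ Finset.range L, ∫ ω, (z k ω).ofLp ⬝ᵥ (z k ω).ofLp ∂P ≤
      c ^ 2 * ∑ k ∈ Finset.range L, ∫ ω, (w k ω).ofLp ⬝ᵥ (w k ω).ofLp ∂P) :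
    l2eNorm P z ≤ ENNReal.ofReal c * l2eNorm P w := by
  rw [← ENNReal.pow_le_pow_left_iff two_ne_zero, mul_pow, l2eNorm_sq, l2eNorm_sq,
    ENNReal.tsum_eq_iSup_nat]
  refine iSup_le fun L => ?_
  rw [sum_lintegral_enorm_sq hz]
  refine (ENNReal.ofReal_le_ofReal (h L)).trans ?_
  rw [ENNReal.ofReal_mul (by positivity), ENNReal.ofReal_pow hc, ← sum_lintegral_enorm_sq hw]
  gcongr
  exact ENNReal.sum_le_tsum _

theorem sum_le_of_l2eNorm_le {z : ℕ → Ω → EuclideanSpace ℝ (Fin q)}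
    {w : ℕ → Ω → EuclideanSpace ℝ (Fin r)}
    (hz : ∀ k, Integrable (fun ω => (z k ω).ofLp ⬝ᵥ (z k ω).ofLp) P)
    (hw : ∀ k, Integrable (fun ω => (w k ω).ofLp ⬝ᵥ (w k ω).ofLp) P) {c : ℝ} (hc : 0 ≤ c)
    {L : ℕ} (hL : ∀ k, L ≤ k → w k = 0) (h : l2eNorm P z ≤ ENNReal.ofReal c * l2eNorm P w) :
    ∑ k ∈ Finset.range L, ∫ ω, (z k ω).ofLp ⬝ᵥ (z k ω).ofLp ∂P ≤
      c ^ 2 * ∑ k ∈ Finset.range L, ∫ ω, (w k ω).ofLp ⬝ᵥ (w k ω).ofLp ∂P := by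
  rw [← ENNReal.pow_le_pow_left_iff two_ne_zero, mul_pow, l2eNorm_sq, l2eNorm_sq,
    tsum_eq_sum (s := Finset.range L) (f := fun k => ∫⁻ ω, ‖w k ω‖ₑ ^ 2 ∂P)] at h
  · have h' := (ENNReal.sum_le_tsum (Finset.range L)).trans h
    rw [sum_lintegral_enorm_sq hz, sum_lintegral_enorm_sq hw, ← ENNReal.ofReal_pow hc,
      ← ENNReal.ofReal_mul (by positivity)] at h'
    refine (ENNReal.ofReal_le_ofReal_iff ?_).1 h'
    exact mul_nonneg (by positivity) (Finset.sum_nonneg fun k _ =>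
      integral_nonneg fun ω => dotProduct_self_nonneg_real _)
  · intro k hk
    rw [Finset.mem_range, not_lt] at hk
    simp [hL k hk]

theorem IsDisturbance.isL2Adapted {w : ℕ → Ω → EuclideanSpace ℝ (Fin m)}
    (hw : IsDisturbance P θ w) (k : ℕ) : IsL2Adapted P θ w k fun ω => (w k ω).ofLp := by
  refine ⟨fun a => ?_, fun a => ?_⟩
  · have h1 : Measurable fun v : EuclideanSpace ℝ (Fin m) => v.ofLp a := by fun_prop
    exact h1.comp (measurable_history_input le_rfl)
  · have hfin : ∑' k, ∫⁻ ω, ‖w k ω‖ₑ ^ 2 ∂P < ∞ := by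
      rw [← l2eNorm_sq]
      exact ENNReal.pow_lt_top hw.finite
    have hk : ∫⁻ ω, ‖w k ω‖ₑ ^ 2 ∂P < ∞ := (ENNReal.le_tsum k).trans_lt hfin
    have hmem : MemLp (w k) 2 P := by
      refine ⟨(hw.measurable k).aestronglyMeasurable, ?_⟩
      rw [eLpNorm_lt_top_iff_lintegral_rpow_enorm_lt_top two_ne_zero ENNReal.ofNat_ne_top]
      simpa using hk
    refine hmem.of_le (Measurable.aestronglyMeasurable ?_) (Filter.Eventually.of_forall fun ω => ?_)
    · have h1 : Measurable fun v : EuclideanSpace ℝ (Fin m) => v.ofLp a := by fun_prop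
      exact h1.comp (hw.measurable k)
    · exact PiLp.norm_apply_le (w k ω) a

/-- Given the mode path up to time `k`, such an input is almost surely constant, hence independent
of everything. -/
theorem nonanticipative_of_path (hθ : ∀ k, Measurable (θ k))
    (W : ℕ → (ℕ → Fin N) → EuclideanSpace ℝ (Fin m))
    (hW : ∀ k h h', (∀ l ≤ k, h l = h' l) → W k h = W k h') :
    Nonanticipative P θ fun k ω => W k fun l => θ l ω := by
  intro k h
  have hEm : MeasurableSet {ω | ∀ l ≤ k, θ l ω = h l} := by
    have : {ω | ∀ l ≤ k, θ l ω = h l} = ⋂ l, ⋂ (_ : l ≤ k), θ l ⁻¹' {h l} := by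
      ext ω; simp
    rw [this]
    exact MeasurableSet.iInter fun l => MeasurableSet.iInter fun _ =>
      hθ l (measurableSet_singleton _)
  by_cases h0 : P[|{ω | ∀ l ≤ k, θ l ω = h l}] = 0
  · rw [h0, IndepFun_iff]
    simp
  · have : IsProbabilityMeasure P[|{ω | ∀ l ≤ k, θ l ω = h l}] := by
      rw [cond_eq_zero, not_or] at h0
      exact cond_isProbabilityMeasure_of_finite h0.2 h0.1
    refine (indepFun_const_left (fun l : Fin (k + 1) => W l h) (θ (k + 1))).congr ?_
      (Filter.EventuallyEq.refl _ _)
    refine ae_cond_of_forall_mem hEm fun ω hω => ?_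
    funext l
    exact (hW l _ _ fun l' hl' => hω l' (by omega)).symm

theorem isDisturbance_zero (hθ : ∀ k, Measurable (θ k)) :
    IsDisturbance P θ (fun _ _ => (0 : EuclideanSpace ℝ (Fin m))) :=
  ⟨fun _ => measurable_const, by simp [l2eNorm],
    nonanticipative_of_path hθ (fun _ _ => 0) fun _ _ _ _ => rfl⟩

end MeanSquareNorm

/-! ### State and error as adapted processes -/

namespace SMJLS

variable {n m p N J : ℕ} (S : SMJLS n m p N J) {Ω : Type*} [mΩ : MeasurableSpace Ω]
  {P : Measure Ω} {θ : ℕ → Ω → Fin N}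
  {v w : ℕ → Ω → EuclideanSpace ℝ (Fin m)}

theorem isSymm_condGram (k t : ℕ) (i : Fin N) : (S.condGram P θ k t i).IsSymm := by
  ext a b
  simp only [condGram, Matrix.transpose_apply, Matrix.of_apply]
  congr 1
  funext ω
  simp only [Matrix.mul_apply, Matrix.transpose_apply, mul_comm]

variable [IsProbabilityMeasure P]

/-- The process `v` that generates the history is kept apart from the input `w`: a general
disturbance uses `v = w`, while a feedback input is a function of the modes and uses `v = 0`. -/
theorem isL2Adapted_state (hθ : ∀ k, Measurable (θ k))
    (hw : ∀ k, IsL2Adapted P θ v k fun ω => (w k ω).ofLp) (k : ℕ) :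
    IsL2Adapted P θ v k fun ω => S.state (fun l => θ l ω) (fun l => w l ω) k := by
  induction k with
  | zero => exact IsL2Adapted.of_chain hθ fun _ => 0
  | succ k ih => exact ((ih.mulVec hθ S.A).add ((hw k).mulVec hθ S.B)).mono (Nat.le_succ k)

theorem isL2Adapted_error (hθ : ∀ k, Measurable (θ k))
    (hw : ∀ k, IsL2Adapted P θ v k fun ω => (w k ω).ofLp) (k : ℕ) :
    IsL2Adapted P θ v k fun ω => (S.error θ w k ω).ofLp :=
  ((S.isL2Adapted_state hθ hw k).mulVec hθ S.C).add ((hw k).mulVec hθ S.D)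

/-! ### The free response -/

theorem Phi_self (h : ℕ → Fin N) (t : ℕ) : S.Phi h t t = 1 := by
  cases t <;> simp [Phi]

theorem Phi_succ (h : ℕ → Fin N) {t k : ℕ} (hk : t ≤ k) :
    S.Phi h t (k + 1) = S.A (h k) * S.Phi h t k := by
  simp [Phi, hk]

theorem isL2Adapted_Phi (hθ : ∀ k, Measurable (θ k)) (t : ℕ) (g : Fin N → Fin n → ℝ) (s : ℕ) :
    IsL2Adapted P θ v (t + s) fun ω => S.Phi (fun l => θ l ω) t (t + s) *ᵥ g (θ t ω) := by
  induction s with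
  | zero =>
    simp only [add_zero, Phi_self, Matrix.one_mulVec]
    exact IsL2Adapted.of_chain hθ g
  | succ s ih =>
    have := (ih.mulVec hθ S.A).mono (Nat.le_succ _)
    simp only [← Nat.add_assoc, Phi_succ S _ (Nat.le_add_right t s), ← Matrix.mulVec_mulVec]
    exact this


/-- Starting from `x` in mode `i` and from zero in all other modes replaces conditioning on `θ(t) =
i` by an unconditional expectation, at the price of the factor `P(θ(t) = i)`. -/
theorem integral_free_response (hθ : ∀ k, Measurable (θ k)) (t s : ℕ)
    (i : Fin N) (hi : 0 < P.real {ω | θ t ω = i}) (x : Fin n → ℝ) :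
    ∫ ω, (S.Phi (fun l => θ l ω) t (t + s) *ᵥ (if θ t ω = i then x else 0)) ⬝ᵥ
        (S.Phi (fun l => θ l ω) t (t + s) *ᵥ (if θ t ω = i then x else 0)) ∂P =
      P.real {ω | θ t ω = i} * quad (S.condGram P θ (t + s) t i) x := by
  classical
  have him : MeasurableSet {ω | θ t ω = i} := hθ t (measurableSet_singleton i)
  have hΦ : ∀ a, IsL2Adapted P θ (fun _ _ => (0 : EuclideanSpace ℝ (Fin m))) (t + s)
      fun ω => S.Phi (fun l => θ l ω) t (t + s) *ᵥ (Pi.single a 1 : Fin n → ℝ) := fun a =>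
    S.isL2Adapted_Phi hθ t (fun _ => Pi.single a 1) s
  have hent : ∀ a b, Integrable (fun ω => ((S.Phi (fun l => θ l ω) t (t + s))ᵀ *
      S.Phi (fun l => θ l ω) t (t + s)) a b) P := by
    intro a b
    have := (hΦ a).integrable_dotProduct (hΦ b)
    simpa [Matrix.mul_apply, dotProduct] using this
  have hentc : ∀ a b, Integrable (fun ω => ((S.Phi (fun l => θ l ω) t (t + s))ᵀ *
      S.Phi (fun l => θ l ω) t (t + s)) a b) (P[|{ω | θ t ω = i}]) := by
    intro a b
    rw [ProbabilityTheory.cond]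
    refine (hent a b).integrableOn.integrable.smul_measure ?_
    rw [ENNReal.inv_ne_top]
    intro h0
    rw [Measure.real, h0] at hi
    simp at hi
  have hq : quad (S.condGram P θ (t + s) t i) x =
      ∫ ω, quad ((S.Phi (fun l => θ l ω) t (t + s))ᵀ * S.Phi (fun l => θ l ω) t (t + s)) x
        ∂(P[|{ω | θ t ω = i}]) := by
    simp only [quad, dotProduct, Matrix.mulVec, condGram, Matrix.of_apply]
    rw [integral_finsetSum]
    · refine Finset.sum_congr rfl fun a _ => ?_
      rw [integral_const_mul, integral_finsetSum]
      · congr 1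
        refine Finset.sum_congr rfl fun b _ => ?_
        rw [integral_mul_const]
      · exact fun b _ => (hentc a b).mul_const _
    · exact fun a _ => (integrable_finsetSum _ fun b _ => (hentc a b).mul_const _).const_mul _
  rw [hq, ProbabilityTheory.cond, integral_smul_measure, ENNReal.toReal_inv, ← Measure.real_def,
    smul_eq_mul, mul_inv_cancel_left₀ hi.ne', ← integral_indicator him]
  refine integral_congr_ae (Filter.Eventually.of_forall fun ω => ?_)
  by_cases h : θ t ω = i
  · simp only [h, if_true]
    rw [Set.indicator_of_mem (by exact h), quad_transpose_mul]
  · simp only [h, if_false]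
    rw [Set.indicator_of_notMem (by exact h)]
    simp

end SMJLS

/-! ### Storage functions give stability and contractivity -/

namespace SMJLS

variable {n m p N J : ℕ} (S : SMJLS n m p N J) {Ω : Type*} [mΩ : MeasurableSpace Ω]
  {P : Measure Ω} [IsProbabilityMeasure P] {θ : ℕ → Ω → Fin N}

/-- `Z` is a family of storage functions along `ψ` with dissipation rate `ε`. -/
def IsStorage (ψ : ℕ → Fin J) (Z : ℕ → Fin N → Matrix (Fin n) (Fin n) ℝ) (ε : ℝ) : Prop :=
  ∀ k i x u, quad (S.meanNext (ψ k) i (Z (k + 1))) (S.A i *ᵥ x + S.B i *ᵥ u)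
      + (S.C i *ᵥ x + S.D i *ᵥ u) ⬝ᵥ (S.C i *ᵥ x + S.D i *ᵥ u) - u ⬝ᵥ u ≤
    quad (Z k i) x - ε * (x ⬝ᵥ x + u ⬝ᵥ u)

variable {S} {ψ : ℕ → Fin J} {Z : ℕ → Fin N → Matrix (Fin n) (Fin n) ℝ} {ε : ℝ}

theorem IsStorage.sum_error_le (hZ : S.IsStorage ψ Z ε) (hε : 0 ≤ ε)
    (hZ0 : ∀ k i x, 0 ≤ quad (Z k i) x)
    (hmc : IsMarkovChain P (fun k => S.trans (ψ k)) S.p0 θ)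
    {w : ℕ → Ω → EuclideanSpace ℝ (Fin m)} (hw : IsDisturbance P θ w) (L : ℕ) :
    ∑ k ∈ Finset.range L, ∫ ω, (S.error θ w k ω).ofLp ⬝ᵥ (S.error θ w k ω).ofLp ∂P ≤
      (1 - ε) * ∑ k ∈ Finset.range L, ∫ ω, (w k ω).ofLp ⬝ᵥ (w k ω).ofLp ∂P := by
  have hθ := hmc.measurable
  have hwa := hw.isL2Adapted
  have hxa := S.isL2Adapted_state hθ hwa
  have hza := S.isL2Adapted_error hθ hwa
  set x : ℕ → Ω → Fin n → ℝ := fun k ω => S.state (fun l => θ l ω) (fun l => w l ω) k with hx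
  -- The induction carries the stored energy at time `L`, which is nonnegative and is dropped at the
  -- end.
  suffices h : ∫ ω, quad (Z L (θ L ω)) (x L ω) ∂P +
      ∑ k ∈ Finset.range L, ∫ ω, (S.error θ w k ω).ofLp ⬝ᵥ (S.error θ w k ω).ofLp ∂P ≤
      (1 - ε) * ∑ k ∈ Finset.range L, ∫ ω, (w k ω).ofLp ⬝ᵥ (w k ω).ofLp ∂P by
    have := integral_nonneg (μ := P) (f := fun ω => quad (Z L (θ L ω)) (x L ω))
      fun ω => hZ0 L (θ L ω) (x L ω)
    linarith
  induction L with
  | zero => simp [hx, state]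
  | succ L ih =>
    rw [Finset.sum_range_succ, Finset.sum_range_succ, mul_add]
    -- The state at time `L + 1` is determined by the history up to time `L`, so only the mode `θ(L
    -- + 1)` is averaged.
    have hy := ((hxa L).mulVec hθ S.A).add ((hwa L).mulVec hθ S.B)
    have hnext := integral_quad_next hmc hw.measurable hw.nonanticipative hy (Z (L + 1))
    have hstep : ∫ ω, quad (Z (L + 1) (θ (L + 1) ω)) (x (L + 1) ω) ∂P +
        ∫ ω, (S.error θ w L ω).ofLp ⬝ᵥ (S.error θ w L ω).ofLp ∂P ≤
        ∫ ω, quad (Z L (θ L ω)) (x L ω) ∂P +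
          (1 - ε) * ∫ ω, (w L ω).ofLp ⬝ᵥ (w L ω).ofLp ∂P := by
      have i1 := hy.integrable_quad hθ fun i => S.meanNext (ψ L) i (Z (L + 1))
      have i2 := (hza L).integrable_dotProduct (hza L)
      have i3 := (hxa L).integrable_quad hθ (Z L)
      have i4 := ((hwa L).integrable_dotProduct (hwa L)).const_mul (1 - ε)
      have e : ∫ ω, quad (Z (L + 1) (θ (L + 1) ω)) (x (L + 1) ω) ∂P = _ := hnext
      rw [e, ← integral_const_mul]
      refine le_of_eq_of_le (integral_add i1 i2).symm
        (le_of_le_of_eq (integral_mono (i1.add i2) (i3.add i4) fun ω => ?_) (integral_add i3 i4))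
      have := hZ L (θ L ω) (x L ω) (w L ω).ofLp
      have hxx := mul_nonneg hε (dotProduct_self_nonneg_real (x L ω))
      simp only [error, hx, Pi.add_apply] at this hxx ⊢
      linarith
    linarith

/-- With zero input each step loses at least `ε ‖x‖²`, hence at least the fraction `ε/β` of the
stored energy. The bounds `α` and `β` convert stored energy to state energy at the two ends. -/
theorem IsStorage.quad_condGram_le (hZ : S.IsStorage ψ Z ε) (hε : 0 ≤ ε) {α β : ℝ} (hα : 0 < α)
    (hαZ : ∀ k i x, α * (x ⬝ᵥ x) ≤ quad (Z k i) x)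
    (hβ : 0 < β) (hβZ : ∀ k i x, quad (Z k i) x ≤ β * (x ⬝ᵥ x)) (hεβ : ε ≤ β)
    (hmc : IsMarkovChain P (fun k => S.trans (ψ k)) S.p0 θ) (t s : ℕ) (i : Fin N)
    (hi : 0 < P.real {ω | θ t ω = i}) (x : Fin n → ℝ) :
    quad (S.condGram P θ (t + s) t i) x ≤ β / α * (1 - ε / β) ^ s * (x ⬝ᵥ x) := by
  have hθ := hmc.measurable
  have hw0 := isDisturbance_zero (P := P) (m := m) hθ
  set f : ℕ → Ω → Fin n → ℝ := fun s ω =>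
    S.Phi (fun l => θ l ω) t (t + s) *ᵥ (if θ t ω = i then x else 0) with hf
  have hfa : ∀ s, IsL2Adapted P θ (fun _ _ => (0 : EuclideanSpace ℝ (Fin m))) (t + s) (f s) :=
    fun s => S.isL2Adapted_Phi hθ t (fun j => if j = i then x else 0) s
  have him : MeasurableSet {ω | θ t ω = i} := hθ t (measurableSet_singleton i)
  have hdecay : ∀ s, ∫ ω, quad (Z (t + s) (θ (t + s) ω)) (f s ω) ∂P ≤
      (1 - ε / β) ^ s * (β * (P.real {ω | θ t ω = i} * (x ⬝ᵥ x))) := by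
    intro s
    induction s with
    | zero =>
      rw [pow_zero, one_mul, ← smul_eq_mul (P.real _), ← setIntegral_const,
        ← integral_indicator him, ← integral_const_mul]
      refine integral_mono ((hfa 0).integrable_quad hθ (Z t))
        (((integrable_const _).indicator him).const_mul β) fun ω => ?_
      have : f 0 ω = if θ t ω = i then x else 0 := by
        simp [hf, Phi_self]
      simp only [this, add_zero]
      by_cases h : θ t ω = i
      · rw [if_pos h, Set.indicator_of_mem (by exact h)]
        exact hβZ t (θ t ω) x
      · rw [if_neg h, Set.indicator_of_notMem (by exact h)]
        simp
    | succ s ih =>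
      have hy := (hfa s).mulVec hθ S.A
      have hnext := integral_quad_next hmc hw0.measurable hw0.nonanticipative hy (Z (t + s + 1))
      have e1 : ∀ ω, f (s + 1) ω = S.A (θ (t + s) ω) *ᵥ f s ω := fun ω => by
        simp only [hf, ← Nat.add_assoc, Phi_succ S _ (Nat.le_add_right t s),
          ← Matrix.mulVec_mulVec]
      simp only [← Nat.add_assoc, e1]
      rw [hnext, pow_succ', mul_assoc]
      have hρ : 0 ≤ 1 - ε / β := by
        rw [sub_nonneg, div_le_one hβ]
        exact hεβ
      refine le_trans ?_ (mul_le_mul_of_nonneg_left ih hρ)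
      rw [← integral_const_mul]
      refine integral_mono (hy.integrable_quad hθ fun i => S.meanNext (ψ (t + s)) i (Z (t + s + 1)))
        (((hfa s).integrable_quad hθ (Z (t + s))).const_mul _) fun ω => ?_
      have h1 := hZ (t + s) (θ (t + s) ω) (f s ω) 0
      simp only [Matrix.mulVec_zero, add_zero, dotProduct_zero, sub_zero] at h1
      have h2 := dotProduct_self_nonneg_real (S.C (θ (t + s) ω) *ᵥ f s ω)
      have h3 : ε / β * quad (Z (t + s) (θ (t + s) ω)) (f s ω) ≤ ε * (f s ω ⬝ᵥ f s ω) := by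
        calc _ ≤ ε / β * (β * (f s ω ⬝ᵥ f s ω)) :=
              mul_le_mul_of_nonneg_left (hβZ _ _ _) (by positivity)
          _ = _ := by field_simp
      have h4 : quad (S.meanNext (ψ (t + s)) (θ (t + s) ω) (Z (t + s + 1)))
          (S.A (θ (t + s) ω) *ᵥ f s ω) ≤ (1 - ε / β) * quad (Z (t + s) (θ (t + s) ω)) (f s ω) := by
        linarith
      exact h4
  have hlow : α * ∫ ω, f s ω ⬝ᵥ f s ω ∂P ≤ ∫ ω, quad (Z (t + s) (θ (t + s) ω)) (f s ω) ∂P := by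
    rw [← integral_const_mul]
    exact integral_mono (((hfa s).integrable_dotProduct (hfa s)).const_mul α)
      ((hfa s).integrable_quad hθ (Z (t + s))) fun ω => hαZ _ _ _
  have hE := S.integral_free_response hθ t s i hi x
  have h := hlow.trans (hdecay s)
  rw [show ∫ ω, f s ω ⬝ᵥ f s ω ∂P = _ from hE] at h
  have h' : P.real {ω | θ t ω = i} * (α * quad (S.condGram P θ (t + s) t i) x) ≤
      P.real {ω | θ t ω = i} * ((1 - ε / β) ^ s * (β * (x ⬝ᵥ x))) := by
    calc _ = α * (P.real {ω | θ t ω = i} * quad (S.condGram P θ (t + s) t i) x) := by ring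
      _ ≤ _ := h
      _ = _ := by ring
  have h'' := le_of_mul_le_mul_left h' hi
  calc quad (S.condGram P θ (t + s) t i) x =
        (α * quad (S.condGram P θ (t + s) t i) x) / α := by field_simp
    _ ≤ ((1 - ε / β) ^ s * (β * (x ⬝ᵥ x))) / α := by gcongr
    _ = _ := by ring

theorem stable_and_contractive_of_brl {θ : (ℕ → Fin J) → ℕ → Ω → Fin N}
    (hθ : ∀ ψ ∈ S.Psi, IsMarkovChain P (fun k => S.trans (ψ k)) S.p0 (θ ψ))
    (hpos : ∀ ψ ∈ S.Psi, ∀ (i : Fin N) (k : ℕ), 0 < P.real {ω | θ ψ k ω = i})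
    (M : ℕ) (X : Fin N → S.windows M → Matrix (Fin n) (Fin n) ℝ) (hX : ∀ i r, (X i r).PosDef)
    (hbrl : ∀ (r : S.windows (M + 1)) (i : Fin N),
      (-(S.brl i (∑ j : Fin N, S.trans (r.1 0) i j • X j (S.tailWindow r))
        (X i (S.initWindow r)))).PosDef) :
    S.UniformlyExpMeanSquareStable P θ ∧ S.UniformlyMeanSquareStrictlyContractive P θ := by
  obtain ⟨α, hα, hαX⟩ := exists_le_quad_of_posDef
    (fun a : Fin N × S.windows M => X a.1 a.2) fun a => hX a.1 a.2
  obtain ⟨β₀, hβ₀, hβX⟩ := exists_quad_le (fun a : Fin N × S.windows M => X a.1 a.2)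
  obtain ⟨ε₀, hε₀, hεX⟩ := exists_le_quad_of_posDef
    (fun a : S.windows (M + 1) × Fin N => -(S.brl a.2
      (∑ j : Fin N, S.trans (a.1.1 0) a.2 j • X j (S.tailWindow a.1))
        (X a.2 (S.initWindow a.1)))) fun a => hbrl a.1 a.2
  -- `ε < 1` keeps the gain `√(1 - ε)` positive. Below, `α ≤ β` gives `c = β/α ≥ 1`, and `ε ≤ β`
  -- gives a nonnegative rate `1 - ε/β`.
  obtain ⟨ε, hε, hεle, hε1⟩ : ∃ ε : ℝ, 0 < ε ∧ ε ≤ ε₀ ∧ ε < 1 :=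
    ⟨min ε₀ (1 / 2), by positivity, min_le_left _ _,
      (min_le_right _ _).trans_lt (by norm_num)⟩
  obtain ⟨β, hβ, hβle, hαβ, hεβ⟩ : ∃ β : ℝ, 0 < β ∧ β₀ ≤ β ∧ α ≤ β ∧ ε ≤ β :=
    ⟨max β₀ (max α ε), by positivity, le_max_left _ _,
      (le_max_left _ _).trans (le_max_right _ _), (le_max_right _ _).trans (le_max_right _ _)⟩
  let win : ∀ ψ ∈ S.Psi, ℕ → S.windows M := fun ψ hψ k => ⟨fun l => ψ (k + l), ψ, hψ, k, rfl⟩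
  have hstor : ∀ ψ (hψ : ψ ∈ S.Psi), S.IsStorage ψ (fun k i => X i (win ψ hψ k)) ε := by
    intro ψ hψ k i x u
    let r : S.windows (M + 1) := ⟨fun l => ψ (k + l), ψ, hψ, k, rfl⟩
    have h := hεX (r, i) (Sum.elim x u)
    have htail : S.tailWindow r = win ψ hψ (k + 1) := by
      refine Subtype.ext (funext fun l => ?_)
      simp only [tailWindow, r, win, Fin.val_succ]
      congr 1
      omega
    have hinit : S.initWindow r = win ψ hψ k := rfl
    rw [quad_neg, quad_brl, sumElim_dotProduct_sumElim] at h
    simp only [htail, hinit] at h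
    have hxu := mul_le_mul_of_nonneg_right hεle
      (add_nonneg (dotProduct_self_nonneg_real x) (dotProduct_self_nonneg_real u))
    have hr : r.1 0 = ψ k := rfl
    rw [hr] at h
    simp only [meanNext]
    linarith
  have hXnonneg : ∀ ψ (hψ : ψ ∈ S.Psi) k i x, 0 ≤ quad (X i (win ψ hψ k)) x := fun ψ hψ k i x =>
    (mul_nonneg hα.le (dotProduct_self_nonneg_real x)).trans (hαX (i, win ψ hψ k) x)
  refine ⟨⟨β / α, 1 - ε / β, ?_, ?_, ?_, ?_⟩, ⟨Real.sqrt (1 - ε), ?_, ?_, ?_⟩⟩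
  · rwa [one_le_div hα]
  · rw [sub_nonneg, div_le_one hβ]
    exact hεβ
  · have := div_pos hε hβ
    linarith
  · intro ψ hψ i k t htk
    obtain ⟨s, rfl⟩ := Nat.exists_eq_add_of_le htk
    refine posSemidef_iff_quad.2 ⟨?_, fun x => ?_⟩
    · rw [Matrix.IsSymm, Matrix.transpose_sub, (S.isSymm_condGram _ _ _).eq,
        Matrix.transpose_smul, Matrix.transpose_one]
    · rw [quad_sub, quad_smul, quad_one, sub_nonneg, Nat.add_sub_cancel_left]
      refine (hstor ψ hψ).quad_condGram_le hε.le hα (fun k i x => hαX (i, win ψ hψ k) x) hβ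
        (fun k i x => ?_) hεβ (hθ ψ hψ) t s i (hpos ψ hψ i t) x
      exact (hβX (i, win ψ hψ k) x).trans
        (mul_le_mul_of_nonneg_right hβle (dotProduct_self_nonneg_real x))
  · exact Real.sqrt_pos.2 (by linarith)
  · rw [Real.sqrt_lt' one_pos]
    linarith
  · intro ψ hψ w hw
    have hwa := hw.isL2Adapted
    have hza := S.isL2Adapted_error (hθ ψ hψ).measurable hwa
    refine l2eNorm_le_mul (fun k => (hza k).integrable_dotProduct (hza k))
      (fun k => (hwa k).integrable_dotProduct (hwa k)) (Real.sqrt_nonneg _) fun L => ?_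
    rw [Real.sq_sqrt (by linarith)]
    exact (hstor ψ hψ).sum_error_le hε.le (hXnonneg ψ hψ) (hθ ψ hψ) hw L

end SMJLS

namespace SMJLS

variable {n m p N J : ℕ} (S : SMJLS n m p N J)

/-! ### Backward Lyapunov and Riccati recursions -/

/-- The truncation to `k` steps of the Lyapunov series `∑ E[ΦᵀΦ]`. -/
def lyapunov : ℕ → (ℕ → Fin J) → Fin N → Matrix (Fin n) (Fin n) ℝ
  | 0, _, _ => 1
  | k + 1, σ, i =>
    1 + (S.A i)ᵀ * S.meanNext (σ 0) i (lyapunov k fun l => σ (l + 1)) * S.A i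

theorem lyapunov_congr (k : ℕ) {σ τ : ℕ → Fin J} (h : ∀ l < k, σ l = τ l) :
    S.lyapunov k σ = S.lyapunov k τ := by
  induction k generalizing σ τ with
  | zero => rfl
  | succ k ih =>
    funext i
    rw [lyapunov, lyapunov, h 0 (by omega), ih fun l hl => h (l + 1) (by omega)]

theorem isSymm_lyapunov (k : ℕ) (σ : ℕ → Fin J) (i : Fin N) : (S.lyapunov k σ i).IsSymm := by
  induction k generalizing σ i with
  | zero => exact Matrix.isSymm_one
  | succ k ih =>
    have := S.isSymm_meanNext (σ 0) i fun j => ih (fun l => σ (l + 1)) j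
    rw [Matrix.IsSymm, lyapunov, Matrix.transpose_add, Matrix.transpose_one, Matrix.transpose_mul,
      Matrix.transpose_mul, this.eq, Matrix.transpose_transpose, Matrix.mul_assoc]

theorem quad_lyapunov_succ (k : ℕ) (σ : ℕ → Fin J) (i : Fin N) (x : Fin n → ℝ) :
    quad (S.lyapunov (k + 1) σ i) x = x ⬝ᵥ x +
      quad (S.meanNext (σ 0) i (S.lyapunov k fun l => σ (l + 1))) (S.A i *ᵥ x) := by
  rw [lyapunov, quad_add, quad_one, quad_conj]

theorem le_quad_lyapunov (k : ℕ) (σ : ℕ → Fin J) (i : Fin N) (x : Fin n → ℝ) :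
    x ⬝ᵥ x ≤ quad (S.lyapunov k σ i) x := by
  induction k generalizing σ i x with
  | zero => rw [lyapunov, quad_one]
  | succ k ih =>
    rw [quad_lyapunov_succ]
    have := S.quad_meanNext_nonneg (σ 0) i (Z := S.lyapunov k fun l => σ (l + 1))
      (x := S.A i *ᵥ x) fun j => (dotProduct_self_nonneg_real _).trans (ih _ j _)
    linarith

/-- The cost-to-go over one step, with input weight `1 - ε` and terminal weight `Z`. -/
def stepCost (ε : ℝ) (i : Fin N) (Z : Matrix (Fin n) (Fin n) ℝ) (x : Fin n → ℝ)
    (u : Fin m → ℝ) : ℝ :=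
  quad Z (S.A i *ᵥ x + S.B i *ᵥ u)
    + (S.C i *ᵥ x + S.D i *ᵥ u) ⬝ᵥ (S.C i *ᵥ x + S.D i *ᵥ u) - (1 - ε) * (u ⬝ᵥ u)

/-- The negative of the quadratic input weight in `stepCost`. -/
def inputWeight (ε : ℝ) (i : Fin N) (Z : Matrix (Fin n) (Fin n) ℝ) :
    Matrix (Fin m) (Fin m) ℝ :=
  (1 - ε) • 1 - (S.D i)ᵀ * S.D i - (S.B i)ᵀ * Z * S.B i

/-- The coupling of state and input in `stepCost`. -/
def crossWeight (i : Fin N) (Z : Matrix (Fin n) (Fin n) ℝ) : Matrix (Fin m) (Fin n) ℝ :=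
  (S.B i)ᵀ * Z * S.A i + (S.D i)ᵀ * S.C i

/-- The feedback gain of the input that maximizes `stepCost`. -/
noncomputable def gain (ε : ℝ) (i : Fin N) (Z : Matrix (Fin n) (Fin n) ℝ) :
    Matrix (Fin m) (Fin n) ℝ :=
  (S.inputWeight ε i Z)⁻¹ * S.crossWeight i Z

/-- The Riccati operator, the maximum of `stepCost` over the input. -/
noncomputable def riccati (ε : ℝ) (i : Fin N) (Z : Matrix (Fin n) (Fin n) ℝ) :
    Matrix (Fin n) (Fin n) ℝ :=
  (S.A i)ᵀ * Z * S.A i + (S.C i)ᵀ * S.C i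
    + (S.crossWeight i Z)ᵀ * (S.inputWeight ε i Z)⁻¹ * S.crossWeight i Z

variable {S}

theorem isSymm_inputWeight (ε : ℝ) (i : Fin N) {Z : Matrix (Fin n) (Fin n) ℝ} (hZ : Z.IsSymm) :
    (S.inputWeight ε i Z).IsSymm := by
  simp [Matrix.IsSymm, inputWeight, Matrix.transpose_mul, hZ.eq, Matrix.mul_assoc]

/-- No invertibility is needed: transposition commutes with the matrix inverse even where that takes
its default value zero. So symmetry of `value` is available before well-posedness. -/
theorem isSymm_riccati (ε : ℝ) (i : Fin N) {Z : Matrix (Fin n) (Fin n) ℝ} (hZ : Z.IsSymm) :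
    (S.riccati ε i Z).IsSymm := by
  simp [Matrix.IsSymm, riccati, Matrix.transpose_mul, hZ.eq, Matrix.mul_assoc,
    Matrix.transpose_nonsing_inv, (isSymm_inputWeight ε i hZ).eq]

theorem stepCost_eq {ε : ℝ} {i : Fin N} {Z : Matrix (Fin n) (Fin n) ℝ} (hZ : Z.IsSymm)
    (x : Fin n → ℝ) (u : Fin m → ℝ) :
    S.stepCost ε i Z x u = quad ((S.A i)ᵀ * Z * S.A i + (S.C i)ᵀ * S.C i) x
      + 2 * (u ⬝ᵥ S.crossWeight i Z *ᵥ x) - quad (S.inputWeight ε i Z) u := by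
  have h1 : u ⬝ᵥ S.crossWeight i Z *ᵥ x = (S.A i *ᵥ x) ⬝ᵥ Z *ᵥ (S.B i *ᵥ u) +
      (S.C i *ᵥ x) ⬝ᵥ (S.D i *ᵥ u) := by
    rw [crossWeight, Matrix.add_mulVec, dotProduct_add, ← Matrix.mulVec_mulVec,
      ← Matrix.mulVec_mulVec, ← Matrix.mulVec_mulVec, dotProduct_mulVec_transpose,
      dotProduct_mulVec_transpose, dotProduct_mulVec_symm hZ,
      dotProduct_comm (S.D i *ᵥ u)]
  rw [h1, stepCost, quad_add_vec hZ, inputWeight, quad_sub, quad_sub, quad_smul, quad_one,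
    quad_conj, quad_add, quad_conj, quad_transpose_mul, quad_transpose_mul]
  simp only [dotProduct_add, add_dotProduct]
  rw [dotProduct_comm (S.D i *ᵥ u) (S.C i *ᵥ x)]
  ring

/-- Completion of the square in the input. -/
theorem stepCost_eq_riccati_sub {ε : ℝ} {i : Fin N} {Z : Matrix (Fin n) (Fin n) ℝ}
    (hZ : Z.IsSymm) (hdet : IsUnit (S.inputWeight ε i Z).det) (x : Fin n → ℝ) (u : Fin m → ℝ) :
    S.stepCost ε i Z x u = quad (S.riccati ε i Z) x -
      quad (S.inputWeight ε i Z) (u + (-1 : ℝ) • (S.gain ε i Z *ᵥ x)) := by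
  have hR := isSymm_inputWeight (S := S) ε i hZ
  have hK : S.inputWeight ε i Z *ᵥ (S.gain ε i Z *ᵥ x) = S.crossWeight i Z *ᵥ x := by
    rw [gain, Matrix.mulVec_mulVec, ← Matrix.mul_assoc, Matrix.mul_nonsing_inv _ hdet,
      Matrix.one_mul]
  have hQ : quad (S.inputWeight ε i Z) (S.gain ε i Z *ᵥ x) =
      quad ((S.crossWeight i Z)ᵀ * (S.inputWeight ε i Z)⁻¹ * S.crossWeight i Z) x := by
    rw [quad_conj, quad, hK, quad, gain, ← Matrix.mulVec_mulVec, dotProduct_comm]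
  rw [stepCost_eq hZ, quad_add_vec hR, quad_smul_vec, Matrix.mulVec_smul, dotProduct_smul, hK, hQ,
    riccati, quad_add (_ + _)]
  simp only [smul_eq_mul]
  ring

theorem stepCost_gain {ε : ℝ} {i : Fin N} {Z : Matrix (Fin n) (Fin n) ℝ}
    (hZ : Z.IsSymm) (hdet : IsUnit (S.inputWeight ε i Z).det) (x : Fin n → ℝ) :
    S.stepCost ε i Z x (S.gain ε i Z *ᵥ x) = quad (S.riccati ε i Z) x := by
  rw [stepCost_eq_riccati_sub hZ hdet, neg_one_smul, add_neg_cancel, quad_zero_vec, sub_zero]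

theorem quad_inputWeight {ε : ℝ} {i : Fin N} {Z : Matrix (Fin n) (Fin n) ℝ} (hZ : Z.IsSymm)
    (u : Fin m → ℝ) : quad (S.inputWeight ε i Z) u = -S.stepCost ε i Z 0 u := by
  rw [stepCost_eq hZ]
  simp

variable (S)

/-- The value of the `k`-step problem of maximizing `E[∑ ‖z‖² - (1 - ε) ‖w‖²]`. -/
noncomputable def value (ε : ℝ) : ℕ → (ℕ → Fin J) → Fin N → Matrix (Fin n) (Fin n) ℝ
  | 0, _, _ => 0
  | k + 1, σ, i => S.riccati ε i (S.meanNext (σ 0) i (value ε k fun l => σ (l + 1)))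

theorem value_congr (ε : ℝ) (k : ℕ) {σ τ : ℕ → Fin J} (h : ∀ l < k, σ l = τ l) :
    S.value ε k σ = S.value ε k τ := by
  induction k generalizing σ τ with
  | zero => rfl
  | succ k ih =>
    funext i
    rw [value, value, h 0 (by omega), ih fun l hl => h (l + 1) (by omega)]

theorem isSymm_value (ε : ℝ) (k : ℕ) (σ : ℕ → Fin J) (i : Fin N) : (S.value ε k σ i).IsSymm := by
  induction k generalizing σ i with
  | zero => exact Matrix.isSymm_zero
  | succ k ih => exact isSymm_riccati ε i (S.isSymm_meanNext _ _ fun j => ih _ j)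

/-! ### Closed loop systems -/

/-- The state with feedback gains `K`, additional inputs `v` and state injections `g`. -/
def closedLoop (K : ℕ → Fin N → Matrix (Fin m) (Fin n) ℝ) (v : ℕ → Fin N → Fin m → ℝ)
    (g : ℕ → Fin N → Fin n → ℝ) (h : ℕ → Fin N) : ℕ → Fin n → ℝ
  | 0 => g 0 (h 0)
  | l + 1 => S.A (h l) *ᵥ closedLoop K v g h l
      + S.B (h l) *ᵥ (K l (h l) *ᵥ closedLoop K v g h l + v l (h l)) + g (l + 1) (h (l + 1))

/-- The input of `closedLoop`. -/
def feedback (K : ℕ → Fin N → Matrix (Fin m) (Fin n) ℝ) (v : ℕ → Fin N → Fin m → ℝ)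
    (g : ℕ → Fin N → Fin n → ℝ) (l : ℕ) (h : ℕ → Fin N) : EuclideanSpace ℝ (Fin m) :=
  WithLp.toLp 2 (K l (h l) *ᵥ S.closedLoop K v g h l + v l (h l))

variable {K : ℕ → Fin N → Matrix (Fin m) (Fin n) ℝ} {v : ℕ → Fin N → Fin m → ℝ}
  {g : ℕ → Fin N → Fin n → ℝ}

theorem closedLoop_congr {h h' : ℕ → Fin N} (l : ℕ) (hl : ∀ k ≤ l, h k = h' k) :
    S.closedLoop K v g h l = S.closedLoop K v g h' l := by
  induction l with
  | zero => rw [closedLoop, closedLoop, hl 0 le_rfl]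
  | succ l ih =>
    rw [closedLoop, closedLoop, ih fun k hk => hl k (by omega), hl l (by omega), hl (l + 1) le_rfl]

theorem feedback_congr (l : ℕ) (h h' : ℕ → Fin N) (hl : ∀ k ≤ l, h k = h' k) :
    S.feedback K v g l h = S.feedback K v g l h' := by
  rw [feedback, feedback, S.closedLoop_congr l hl, hl l le_rfl]

variable {Ω : Type*} [mΩ : MeasurableSpace Ω] {P : Measure Ω} [IsProbabilityMeasure P]
  {θ : ℕ → Ω → Fin N} {w : ℕ → Ω → EuclideanSpace ℝ (Fin m)}

theorem isL2Adapted_closedLoop (hθ : ∀ k, Measurable (θ k)) (l : ℕ) :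
    IsL2Adapted P θ w l fun ω => S.closedLoop K v g (fun k => θ k ω) l := by
  induction l with
  | zero => exact IsL2Adapted.of_chain hθ (g 0)
  | succ l ih =>
    exact (((ih.mulVec hθ S.A).add (((ih.mulVec hθ (K l)).add
      (IsL2Adapted.of_chain hθ (v l))).mulVec hθ S.B)).mono (Nat.le_succ l)).add
        (IsL2Adapted.of_chain hθ (g (l + 1)))

theorem isL2Adapted_feedback (hθ : ∀ k, Measurable (θ k)) (l : ℕ) :
    IsL2Adapted P θ w l fun ω => (S.feedback K v g l fun k => θ k ω).ofLp :=
  ((S.isL2Adapted_closedLoop hθ l).mulVec hθ (K l)).add (IsL2Adapted.of_chain hθ (v l))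

theorem isDisturbance_feedback (hθ : ∀ k, Measurable (θ k)) {L : ℕ}
    (hL : ∀ l h, L ≤ l → S.feedback K v g l h = 0) :
    IsDisturbance P θ fun l ω => S.feedback K v g l fun k => θ k ω := by
  have hwa : ∀ l, IsL2Adapted P θ (fun _ _ => (0 : EuclideanSpace ℝ (Fin m))) l fun ω =>
    (S.feedback K v g l fun k => θ k ω).ofLp := S.isL2Adapted_feedback hθ
  have hint := fun l => (hwa l).integrable_dotProduct (hwa l)
  refine ⟨fun l => ?_, ?_, nonanticipative_of_path hθ (fun l => S.feedback K v g l)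
    S.feedback_congr⟩
  · have h1 : Measurable fun ω => (S.feedback K v g l fun k => θ k ω).ofLp :=
      measurable_pi_lambda _ fun a =>
        ((hwa l).measurable a).mono (history_le hθ (fun _ => measurable_const) l) le_rfl
    exact (WithLp.measurable_toLp 2 _).comp h1
  · refine (ENNReal.pow_lt_top_iff.1 ?_).resolve_right two_ne_zero
    rw [l2eNorm_sq, tsum_eq_sum (s := Finset.range L), sum_lintegral_enorm_sq hint]
    · exact ENNReal.ofReal_lt_top
    · intro l hl
      rw [Finset.mem_range, not_lt] at hl
      simp [hL l _ hl]

end SMJLS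

/-! ### Closed loops started by an impulse, and Lyapunov bounds -/

namespace SMJLS

variable {n m p N J : ℕ} (S : SMJLS n m p N J)

/-- The switching sequence seen from time `t` on. -/
def tailSeq (ψ : ℕ → Fin J) (t : ℕ) : ℕ → Fin J := fun l => ψ (t + l)

theorem tailSeq_succ (ψ : ℕ → Fin J) (t : ℕ) :
    (fun l => tailSeq ψ t (l + 1)) = tailSeq ψ (t + 1) := by
  funext l
  simp only [tailSeq]
  congr 1
  omega

/-- The signal that equals `x` at time `t` in mode `i`, and zero otherwise. -/
def impulse (t : ℕ) (i : Fin N) {q : ℕ} (x : Fin q → ℝ) (l : ℕ) (j : Fin N) : Fin q → ℝ :=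
  if l = t ∧ j = i then x else 0

section ClosedLoop

variable {K : ℕ → Fin N → Matrix (Fin m) (Fin n) ℝ} {t : ℕ} {i : Fin N} {x₀ : Fin n → ℝ}
  {u₀ : Fin m → ℝ}

theorem closedLoop_impulse_of_lt (h : ℕ → Fin N) {l : ℕ} (hl : l < t) :
    S.closedLoop K (impulse t i u₀) (impulse t i x₀) h l = 0 := by
  induction l with
  | zero => simp [closedLoop, impulse, hl.ne]
  | succ l ih =>
    have h1 : l ≠ t := by omega
    rw [closedLoop, ih (by omega)]
    simp [impulse, hl.ne, h1]

theorem feedback_impulse_of_lt (h : ℕ → Fin N) {l : ℕ} (hl : l < t) :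
    S.feedback K (impulse t i u₀) (impulse t i x₀) l h = 0 := by
  rw [feedback, S.closedLoop_impulse_of_lt h hl]
  simp [impulse, hl.ne]

theorem closedLoop_impulse_self (h : ℕ → Fin N) :
    S.closedLoop K (impulse t i u₀) (impulse t i x₀) h t = if h t = i then x₀ else 0 := by
  cases t with
  | zero => simp [closedLoop, impulse]
  | succ t =>
    rw [closedLoop, S.closedLoop_impulse_of_lt h (Nat.lt_succ_self t)]
    simp [impulse]

theorem closedLoop_impulse_succ (h : ℕ → Fin N) {l : ℕ} (hl : t ≤ l) :
    S.closedLoop K (impulse t i u₀) (impulse t i x₀) h (l + 1) =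
      S.A (h l) *ᵥ S.closedLoop K (impulse t i u₀) (impulse t i x₀) h l +
        S.B (h l) *ᵥ (S.feedback K (impulse t i u₀) (impulse t i x₀) l h).ofLp := by
  have h1 : l + 1 ≠ t := by omega
  rw [closedLoop, feedback]
  simp [impulse, h1]

/-- Superposition: the feedback input is replayed as an open-loop disturbance from `x(0) = 0`, where
contractivity applies, and the injected state contributes only a free response. -/
theorem closedLoop_impulse_eq_state_add (h : ℕ → Fin N) (l : ℕ) :
    S.closedLoop K (impulse t i u₀) (impulse t i x₀) h l =
      S.state h (fun l => S.feedback K (impulse t i u₀) (impulse t i x₀) l h) l +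
        if t ≤ l then S.Phi h t l *ᵥ (if h t = i then x₀ else 0) else 0 := by
  induction l with
  | zero =>
    obtain rfl | ht := Nat.eq_zero_or_pos t
    · simp [closedLoop, state, impulse, Phi]
    · rw [S.closedLoop_impulse_of_lt h ht]
      simp [state, ht.ne']
  | succ l ih =>
    obtain hl | hl := le_or_gt t l
    · rw [S.closedLoop_impulse_succ h hl, ih, state, Phi_succ S h hl]
      simp only [if_pos hl, if_pos (show t ≤ l + 1 by omega), Matrix.mulVec_add,
        ← Matrix.mulVec_mulVec]
      abel
    · have hz : S.state h (fun l => S.feedback K (impulse t i u₀) (impulse t i x₀) l h) l = 0 := by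
        rw [S.closedLoop_impulse_of_lt h hl, if_neg (by omega), add_zero] at ih
        exact ih.symm
      rw [state, hz, S.feedback_impulse_of_lt h hl]
      obtain rfl | hl' := Nat.eq_or_lt_of_le (Nat.succ_le_of_lt hl)
      · rw [S.closedLoop_impulse_self, if_pos le_rfl, Nat.succ_eq_add_one, Phi_self]
        simp
      · rw [S.closedLoop_impulse_of_lt h hl', if_neg (by omega)]
        simp

end ClosedLoop

variable {S}
variable {Ω : Type*} [mΩ : MeasurableSpace Ω] {P : Measure Ω}
  {θ : ℕ → Ω → Fin N} {ψ : ℕ → Fin J}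

theorem integral_indicator_mode (hθ : ∀ k, Measurable (θ k)) (t : ℕ) (i : Fin N) (c : ℝ) :
    ∫ ω, (if θ t ω = i then c else 0) ∂P = P.real {ω | θ t ω = i} * c := by
  have him : MeasurableSet {ω | θ t ω = i} := hθ t (measurableSet_singleton i)
  rw [← smul_eq_mul, ← setIntegral_const, ← integral_indicator him]
  simp [Set.indicator]

variable [IsProbabilityMeasure P]

/-! ### Bounds on the Lyapunov recursion from stability -/

/-- Unrolling the recursion, each step contributes the energy of the free response at one time. The
offset `s` is there for the induction. -/
theorem integral_quad_lyapunov (hmc : IsMarkovChain P (fun k => S.trans (ψ k)) S.p0 θ) (t : ℕ)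
    (x : Fin N → Fin n → ℝ) (k s : ℕ) :
    ∫ ω, quad (S.lyapunov k (tailSeq ψ (t + s)) (θ (t + s) ω))
        (S.Phi (fun l => θ l ω) t (t + s) *ᵥ x (θ t ω)) ∂P =
      ∑ r ∈ Finset.range (k + 1), ∫ ω,
        (S.Phi (fun l => θ l ω) t (t + (s + r)) *ᵥ x (θ t ω)) ⬝ᵥ
          (S.Phi (fun l => θ l ω) t (t + (s + r)) *ᵥ x (θ t ω)) ∂P := by
  have hθ := hmc.measurable
  have hw0 := isDisturbance_zero (P := P) (m := m) hθ
  have hfa : ∀ s, IsL2Adapted P θ (fun _ _ => (0 : EuclideanSpace ℝ (Fin m))) (t + s) fun ω =>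
      S.Phi (fun l => θ l ω) t (t + s) *ᵥ x (θ t ω) := S.isL2Adapted_Phi hθ t x
  induction k generalizing s with
  | zero => simp [lyapunov, quad_one]
  | succ k ih =>
    have hy := (hfa s).mulVec hθ S.A
    have hnext := integral_quad_next hmc hw0.measurable hw0.nonanticipative hy
      (S.lyapunov k (tailSeq ψ (t + s + 1)))
    have hsucc : ∀ ω, S.Phi (fun l => θ l ω) t (t + s + 1) *ᵥ x (θ t ω) =
        S.A (θ (t + s) ω) *ᵥ S.Phi (fun l => θ l ω) t (t + s) *ᵥ x (θ t ω) := fun ω => by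
      rw [Phi_succ S _ (Nat.le_add_right t s), Matrix.mulVec_mulVec]
    rw [Finset.sum_range_succ', add_zero]
    have ih' := ih (s + 1)
    simp only [← Nat.add_assoc, hsucc] at ih'
    rw [hnext] at ih'
    have e : ∀ r, t + (s + (r + 1)) = t + s + 1 + r := fun r => by omega
    simp only [e]
    rw [← ih']
    refine Eq.trans ?_ ((integral_add ((hfa s).integrable_dotProduct (hfa s))
      (hy.integrable_quad hθ fun i =>
        S.meanNext (ψ (t + s)) i (S.lyapunov k (tailSeq ψ (t + s + 1))))).trans (add_comm _ _))
    simp only [quad_lyapunov_succ, tailSeq_succ]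
    rfl

theorem sum_pow_le {lam : ℝ} (h0 : 0 ≤ lam) (h1 : lam < 1) (k : ℕ) :
    ∑ r ∈ Finset.range k, lam ^ r ≤ 1 / (1 - lam) := by
  have h : 0 < 1 - lam := by linarith
  rw [le_div_iff₀ h]
  have := geom_sum_mul_neg lam k
  have := pow_nonneg h0 k
  linarith

theorem sum_integral_free_response_le {c lam : ℝ} (hlam0 : 0 ≤ lam)
    (hlam1 : lam < 1) (hc : 0 ≤ c) (hθ : ∀ k, Measurable (θ k)) {t : ℕ} {i : Fin N}
    (hi : 0 < P.real {ω | θ t ω = i})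
    (hgram : ∀ s x, quad (S.condGram P θ (t + s) t i) x ≤ c * lam ^ s * (x ⬝ᵥ x))
    (x : Fin n → ℝ) (k : ℕ) :
    ∑ r ∈ Finset.range k, ∫ ω,
        (S.Phi (fun l => θ l ω) t (t + r) *ᵥ (if θ t ω = i then x else 0)) ⬝ᵥ
          (S.Phi (fun l => θ l ω) t (t + r) *ᵥ (if θ t ω = i then x else 0)) ∂P ≤
      P.real {ω | θ t ω = i} * (c / (1 - lam) * (x ⬝ᵥ x)) := by
  simp only [S.integral_free_response hθ t _ i hi]
  rw [← Finset.mul_sum]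
  refine mul_le_mul_of_nonneg_left ?_ hi.le
  calc ∑ r ∈ Finset.range k, quad (S.condGram P θ (t + r) t i) x
      ≤ ∑ r ∈ Finset.range k, c * (x ⬝ᵥ x) * lam ^ r :=
        Finset.sum_le_sum fun r _ => (hgram r x).trans_eq (by ring)
    _ = c * (x ⬝ᵥ x) * ∑ r ∈ Finset.range k, lam ^ r := (Finset.mul_sum _ _ _).symm
    _ ≤ c * (x ⬝ᵥ x) * (1 / (1 - lam)) := mul_le_mul_of_nonneg_left (sum_pow_le hlam0 hlam1 k)
        (mul_nonneg hc (dotProduct_self_nonneg_real x))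
    _ = _ := by ring

theorem quad_lyapunov_le {c lam : ℝ} (hlam0 : 0 ≤ lam) (hlam1 : lam < 1) (hc : 0 ≤ c)
    (hmc : IsMarkovChain P (fun k => S.trans (ψ k)) S.p0 θ) {t : ℕ} {i : Fin N}
    (hi : 0 < P.real {ω | θ t ω = i})
    (hgram : ∀ s x, quad (S.condGram P θ (t + s) t i) x ≤ c * lam ^ s * (x ⬝ᵥ x))
    (k : ℕ) (x : Fin n → ℝ) :
    quad (S.lyapunov k (tailSeq ψ t) i) x ≤ c / (1 - lam) * (x ⬝ᵥ x) := by
  have h := sum_integral_free_response_le hlam0 hlam1 hc hmc.measurable hi hgram x (k + 1)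
  have h2 := integral_quad_lyapunov hmc t (fun j => if j = i then x else 0) k 0
  simp only [zero_add, add_zero, Phi_self, Matrix.one_mulVec] at h2
  rw [← h2] at h
  have e : ∀ ω, quad (S.lyapunov k (tailSeq ψ t) (θ t ω)) (if θ t ω = i then x else 0) =
      if θ t ω = i then quad (S.lyapunov k (tailSeq ψ t) i) x else 0 := fun ω => by
    split_ifs with hω
    · rw [hω]
    · simp
  simp only [e] at h
  rw [integral_indicator_mode hmc.measurable] at h
  exact le_of_mul_le_mul_left h hi

end SMJLS

namespace SMJLS

variable {n m p N J : ℕ} {S : SMJLS n m p N J}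
variable {Ω : Type*} [mΩ : MeasurableSpace Ω] {P : Measure Ω} [IsProbabilityMeasure P]
  {θ : ℕ → Ω → Fin N} {ψ : ℕ → Fin J}

/-! ### Bounds on the Riccati recursion from stability and contractivity -/

variable (S) in
/-- The optimal gains strictly between the times `t` and `T`, for the horizon `T`. -/
noncomputable def optimalGain (ε : ℝ) (ψ : ℕ → Fin J) (t T l : ℕ) (j : Fin N) :
    Matrix (Fin m) (Fin n) ℝ :=
  if t < l ∧ l < T then
    S.gain ε j (S.meanNext (ψ l) j (S.value ε (T - (l + 1)) (tailSeq ψ (l + 1))))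
  else 0

theorem value_tailSeq (ε : ℝ) {l T : ℕ} (hl : l < T) (j : Fin N) :
    S.value ε (T - l) (tailSeq ψ l) j =
      S.riccati ε j (S.meanNext (ψ l) j (S.value ε (T - (l + 1)) (tailSeq ψ (l + 1)))) := by
  rw [show T - l = T - (l + 1) + 1 by omega, value, tailSeq_succ]
  rfl

theorem integral_stepCost (hmc : IsMarkovChain P (fun k => S.trans (ψ k)) S.p0 θ) (ε : ℝ)
    (Z : Fin N → Matrix (Fin n) (Fin n) ℝ) {l : ℕ} {x : Ω → Fin n → ℝ} {u : Ω → Fin m → ℝ}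
    (hx : IsL2Adapted P θ (fun _ _ => (0 : EuclideanSpace ℝ (Fin m))) l x)
    (hu : IsL2Adapted P θ (fun _ _ => (0 : EuclideanSpace ℝ (Fin m))) l u) :
    ∫ ω, S.stepCost ε (θ l ω) (S.meanNext (ψ l) (θ l ω) Z) (x ω) (u ω) ∂P =
      ∫ ω, (S.C (θ l ω) *ᵥ x ω + S.D (θ l ω) *ᵥ u ω) ⬝ᵥ
        (S.C (θ l ω) *ᵥ x ω + S.D (θ l ω) *ᵥ u ω) ∂P - (1 - ε) * ∫ ω, u ω ⬝ᵥ u ω ∂P +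
      ∫ ω, quad (Z (θ (l + 1) ω)) (S.A (θ l ω) *ᵥ x ω + S.B (θ l ω) *ᵥ u ω) ∂P := by
  have hθ := hmc.measurable
  have hw0 := isDisturbance_zero (P := P) (m := m) hθ
  have hy := (hx.mulVec hθ S.A).add (hu.mulVec hθ S.B)
  have hz := (hx.mulVec hθ S.C).add (hu.mulVec hθ S.D)
  have i1 := hy.integrable_quad hθ fun i => S.meanNext (ψ l) i Z
  have i2 := hz.integrable_dotProduct hz
  have i3 := (hu.integrable_dotProduct hu).const_mul (1 - ε)
  have hnext : _ = ∫ ω, quad (S.meanNext (ψ l) (θ l ω) Z)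
      (S.A (θ l ω) *ᵥ x ω + S.B (θ l ω) *ᵥ u ω) ∂P :=
    integral_quad_next hmc hw0.measurable hw0.nonanticipative hy Z
  rw [hnext, ← integral_const_mul]
  unfold stepCost
  refine (integral_sub (i1.add i2) i3).trans ?_
  have h12 := integral_add i1 i2
  simp only [Pi.add_apply] at h12 ⊢
  rw [h12]
  ring

/-- Dynamic programming: after time `t` the optimal gain turns the current value into stage cost
plus expected next value, so the value unrolls into the accumulated cost. -/
theorem real_mode_mul_stepCost (hmc : IsMarkovChain P (fun k => S.trans (ψ k)) S.p0 θ) (ε : ℝ)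
    {k : ℕ} (hdet : ∀ k' < k, ∀ t i, IsUnit (S.inputWeight ε i
      (S.meanNext (ψ t) i (S.value ε k' (tailSeq ψ (t + 1))))).det)
    (t : ℕ) (i : Fin N) (x₀ : Fin n → ℝ) (u₀ : Fin m → ℝ)
    {y : ℕ → Ω → Fin n → ℝ} {u : ℕ → Ω → Fin m → ℝ}
    (hy : y = fun l ω => S.closedLoop (S.optimalGain ε ψ t (t + k + 1)) (impulse t i u₀)
      (impulse t i x₀) (fun r => θ r ω) l)
    (hu : u = fun l ω => (S.feedback (S.optimalGain ε ψ t (t + k + 1)) (impulse t i u₀)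
      (impulse t i x₀) l fun r => θ r ω).ofLp) :
    P.real {ω | θ t ω = i} * S.stepCost ε i
        (S.meanNext (ψ t) i (S.value ε k (tailSeq ψ (t + 1)))) x₀ u₀ =
      ∑ r ∈ Finset.range (k + 1),
        (∫ ω, (S.C (θ (t + r) ω) *ᵥ y (t + r) ω + S.D (θ (t + r) ω) *ᵥ u (t + r) ω) ⬝ᵥ
          (S.C (θ (t + r) ω) *ᵥ y (t + r) ω + S.D (θ (t + r) ω) *ᵥ u (t + r) ω) ∂P -
          (1 - ε) * ∫ ω, u (t + r) ω ⬝ᵥ u (t + r) ω ∂P) := by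
  have hθ := hmc.measurable
  have hya : ∀ l, IsL2Adapted P θ (fun _ _ => (0 : EuclideanSpace ℝ (Fin m))) l (y l) := fun l => by
    rw [hy]
    exact S.isL2Adapted_closedLoop hθ l
  have hua : ∀ l, IsL2Adapted P θ (fun _ _ => (0 : EuclideanSpace ℝ (Fin m))) l (u l) := fun l => by
    rw [hu]
    exact S.isL2Adapted_feedback hθ l
  have hysucc : ∀ l, t ≤ l → ∀ ω, y (l + 1) ω =
      S.A (θ l ω) *ᵥ y l ω + S.B (θ l ω) *ᵥ u l ω := fun l hl ω => by
    rw [hy, hu]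
    exact S.closedLoop_impulse_succ _ hl
  have hyt : ∀ ω, y t ω = if θ t ω = i then x₀ else 0 := fun ω => by
    rw [hy]
    exact S.closedLoop_impulse_self _
  have hut : ∀ ω, u t ω = if θ t ω = i then u₀ else 0 := fun ω => by
    simp [hu, feedback, optimalGain, impulse]
  have hul : ∀ l, t < l → l < t + k + 1 → ∀ ω, u l ω = S.gain ε (θ l ω) (S.meanNext (ψ l) (θ l ω)
      (S.value ε (t + k + 1 - (l + 1)) (tailSeq ψ (l + 1)))) *ᵥ y l ω := fun l h1 h2 ω => by
    simp only [hu, hy, feedback, optimalGain, impulse]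
    rw [if_pos ⟨h1, h2⟩, if_neg fun hh => h1.ne' hh.1, add_zero]
  -- After the stage `t + s` there remain `k - s` steps, represented by their value; at `s = k` this
  -- value is zero.
  suffices h : ∀ s ≤ k, P.real {ω | θ t ω = i} * S.stepCost ε i
        (S.meanNext (ψ t) i (S.value ε k (tailSeq ψ (t + 1)))) x₀ u₀ =
      ∑ r ∈ Finset.range (s + 1),
        (∫ ω, (S.C (θ (t + r) ω) *ᵥ y (t + r) ω + S.D (θ (t + r) ω) *ᵥ u (t + r) ω) ⬝ᵥ
          (S.C (θ (t + r) ω) *ᵥ y (t + r) ω + S.D (θ (t + r) ω) *ᵥ u (t + r) ω) ∂P -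
          (1 - ε) * ∫ ω, u (t + r) ω ⬝ᵥ u (t + r) ω ∂P) +
      ∫ ω, quad (S.value ε (t + k + 1 - (t + s + 1)) (tailSeq ψ (t + s + 1)) (θ (t + s + 1) ω))
        (y (t + s + 1) ω) ∂P by
    simpa [value] using h k le_rfl
  intro s hs
  induction s with
  | zero =>
    have h := integral_stepCost hmc ε (S.value ε (t + k + 1 - (t + 1)) (tailSeq ψ (t + 1)))
      (hya t) (hua t)
    simp only [← hysucc t le_rfl] at h
    rw [zero_add, Finset.sum_range_one, add_zero, ← h, ← integral_indicator_mode hθ t i]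
    refine integral_congr_ae (Filter.Eventually.of_forall fun ω => ?_)
    simp only [hyt, hut, show t + k + 1 - (t + 1) = k by omega]
    split_ifs with hω
    · rw [hω]
    · simp [stepCost]
  | succ s ih =>
    rw [ih (by omega), Finset.sum_range_succ _ (s + 1)]
    refine (congrArg (_ + ·) ?_).trans (add_assoc _ _ _).symm
    have h := integral_stepCost hmc ε (S.value ε (t + k + 1 - (t + (s + 1) + 1))
      (tailSeq ψ (t + (s + 1) + 1))) (hya (t + (s + 1))) (hua (t + (s + 1)))
    simp only [← hysucc (t + (s + 1)) (by omega)] at h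
    rw [← h]
    refine integral_congr_ae (Filter.Eventually.of_forall fun ω => ?_)
    simp only
    rw [hul (t + (s + 1)) (by omega) (by omega), stepCost_gain, ← value_tailSeq ε (by omega)]
    · rfl
    · exact S.isSymm_meanNext _ _ fun j => S.isSymm_value ε _ _ j
    · exact hdet _ (by omega) _ _

/-- The cost is realized by an input supported on `t, …, t + k`. Young's inequality separates
zero-state and free response. By `hγη` the first costs at most `1 - 2ε` times the input energy, so
against the weight `1 - ε` a surplus `-ε` remains, and the input energy is at least `P(θ(t) = i)
‖u₀‖²`. -/
theorem stepCost_value_le (hmc : IsMarkovChain P (fun k => S.trans (ψ k)) S.p0 θ)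
    (hpos : ∀ (i : Fin N) (k : ℕ), 0 < P.real {ω | θ k ω = i})
    {c lam : ℝ} (hlam0 : 0 ≤ lam) (hlam1 : lam < 1) (hc : 0 ≤ c)
    (hgram : ∀ t i s x, quad (S.condGram P θ (t + s) t i) x ≤ c * lam ^ s * (x ⬝ᵥ x))
    {γ : ℝ} (hγ : 0 ≤ γ) (hcontr : ∀ w : ℕ → Ω → EuclideanSpace ℝ (Fin m), IsDisturbance P θ w →
      l2eNorm P (S.error θ w) ≤ ENNReal.ofReal γ * l2eNorm P w)
    {b : ℝ} (hb : 0 ≤ b) (hC : ∀ i x, (S.C i *ᵥ x) ⬝ᵥ (S.C i *ᵥ x) ≤ b * (x ⬝ᵥ x))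
    {ε η : ℝ} (hε : 0 ≤ ε) (hη : 0 < η) (hγη : (1 + η) * γ ^ 2 ≤ 1 - 2 * ε)
    {k : ℕ} (hdet : ∀ k' < k, ∀ t i, IsUnit (S.inputWeight ε i
      (S.meanNext (ψ t) i (S.value ε k' (tailSeq ψ (t + 1))))).det)
    (t : ℕ) (i : Fin N) (x₀ : Fin n → ℝ) (u₀ : Fin m → ℝ) :
    S.stepCost ε i (S.meanNext (ψ t) i (S.value ε k (tailSeq ψ (t + 1)))) x₀ u₀ ≤
      (1 + 1 / η) * b * (c / (1 - lam)) * (x₀ ⬝ᵥ x₀) - ε * (u₀ ⬝ᵥ u₀) := by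
  have hθ := hmc.measurable
  set K := S.optimalGain ε ψ t (t + k + 1) with hK
  set y : ℕ → Ω → Fin n → ℝ := fun l ω =>
    S.closedLoop K (impulse t i u₀) (impulse t i x₀) (fun r => θ r ω) l with hy
  set w : ℕ → Ω → EuclideanSpace ℝ (Fin m) := fun l ω =>
    S.feedback K (impulse t i u₀) (impulse t i x₀) l fun r => θ r ω with hw
  set f : ℕ → Ω → Fin n → ℝ := fun r ω =>
    S.Phi (fun l => θ l ω) t (t + r) *ᵥ (if θ t ω = i then x₀ else 0) with hf
  have hya : ∀ l, IsL2Adapted P θ (fun _ _ => (0 : EuclideanSpace ℝ (Fin m))) l (y l) :=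
    S.isL2Adapted_closedLoop hθ
  have hwa : ∀ l, IsL2Adapted P θ (fun _ _ => (0 : EuclideanSpace ℝ (Fin m))) l fun ω =>
      (w l ω).ofLp := S.isL2Adapted_feedback hθ
  have hza := S.isL2Adapted_error hθ hwa
  have hfa : ∀ r, IsL2Adapted P θ (fun _ _ => (0 : EuclideanSpace ℝ (Fin m))) (t + r) (f r) :=
    S.isL2Adapted_Phi hθ t fun j => if j = i then x₀ else 0
  have hlate : ∀ l h, t + k + 1 ≤ l →
      S.feedback K (impulse t i u₀) (impulse t i x₀) l h = 0 := fun l h hl => by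
    have h1 : l ≠ t := by omega
    have h2 : ¬ (t < l ∧ l < t + k + 1) := by omega
    simp only [feedback, hK, optimalGain, impulse]
    rw [if_neg h2, if_neg fun hh => h1 hh.1]
    simp
  have hdist : IsDisturbance P θ w := S.isDisturbance_feedback hθ hlate
  have hsum := sum_le_of_l2eNorm_le (fun l => (hza l).integrable_dotProduct (hza l))
    (fun l => (hwa l).integrable_dotProduct (hwa l)) hγ
    (fun l hl => funext fun ω => hlate l _ hl) (hcontr w hdist)
  rw [show t + k + 1 = t + (k + 1) by omega, Finset.sum_range_add _ t (k + 1),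
    Finset.sum_range_add _ t (k + 1)] at hsum
  have hw0 : ∑ l ∈ Finset.range t, ∫ ω, (w l ω).ofLp ⬝ᵥ (w l ω).ofLp ∂P = 0 := by
    refine Finset.sum_eq_zero fun l hl => ?_
    simp only [hw, S.feedback_impulse_of_lt _ (Finset.mem_range.1 hl)]
    simp
  have hz0 : 0 ≤ ∑ l ∈ Finset.range t, ∫ ω, (S.error θ w l ω).ofLp ⬝ᵥ (S.error θ w l ω).ofLp ∂P :=
    Finset.sum_nonneg fun l _ => integral_nonneg fun ω => dotProduct_self_nonneg_real _
  rw [hw0, zero_add] at hsum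
  have hcost := real_mode_mul_stepCost hmc ε hdet t i x₀ u₀ hy
    (u := fun l ω => (w l ω).ofLp) rfl
  have hdecomp : ∀ r ω, y (t + r) ω =
      S.state (fun l => θ l ω) (fun l => w l ω) (t + r) + f r ω := fun r ω => by
    have := S.closedLoop_impulse_eq_state_add (K := K) (t := t) (i := i) (x₀ := x₀) (u₀ := u₀)
      (fun l => θ l ω) (t + r)
    rwa [if_pos (Nat.le_add_right t r)] at this
  have hout : ∀ r, ∫ ω, (S.C (θ (t + r) ω) *ᵥ y (t + r) ω + S.D (θ (t + r) ω) *ᵥ (w (t + r) ω).ofLp)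
        ⬝ᵥ (S.C (θ (t + r) ω) *ᵥ y (t + r) ω + S.D (θ (t + r) ω) *ᵥ (w (t + r) ω).ofLp) ∂P ≤
      (1 + η) * ∫ ω, (S.error θ w (t + r) ω).ofLp ⬝ᵥ (S.error θ w (t + r) ω).ofLp ∂P +
        (1 + 1 / η) * b * ∫ ω, f r ω ⬝ᵥ f r ω ∂P := by
    intro r
    have hζ := ((hya (t + r)).mulVec hθ S.C).add ((hwa (t + r)).mulVec hθ S.D)
    have j1 := ((hza (t + r)).integrable_dotProduct (hza (t + r))).const_mul (1 + η)
    have j2 := ((hfa r).integrable_dotProduct (hfa r)).const_mul ((1 + 1 / η) * b)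
    rw [← integral_const_mul, ← integral_const_mul, ← integral_add j1 j2]
    refine integral_mono (hζ.integrable_dotProduct hζ) (j1.add j2) fun ω => ?_
    have e : S.C (θ (t + r) ω) *ᵥ y (t + r) ω + S.D (θ (t + r) ω) *ᵥ (w (t + r) ω).ofLp =
        (S.error θ w (t + r) ω).ofLp + S.C (θ (t + r) ω) *ᵥ f r ω := by
      rw [hdecomp, Matrix.mulVec_add, error]
      exact add_right_comm _ _ _
    have h1 := dotProduct_add_self_le hη (S.error θ w (t + r) ω).ofLp
      (S.C (θ (t + r) ω) *ᵥ f r ω)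
    have h2 := mul_le_mul_of_nonneg_left (hC (θ (t + r) ω) (f r ω))
      (show 0 ≤ 1 + 1 / η by positivity)
    simp only [e]
    linarith
  have hfsum := sum_integral_free_response_le hlam0 hlam1 hc hθ (hpos i t) (hgram t i) x₀ (k + 1)
  have hwt : P.real {ω | θ t ω = i} * (u₀ ⬝ᵥ u₀) ≤
      ∑ r ∈ Finset.range (k + 1), ∫ ω, (w (t + r) ω).ofLp ⬝ᵥ (w (t + r) ω).ofLp ∂P := by
    have h0 : P.real {ω | θ t ω = i} * (u₀ ⬝ᵥ u₀) =
        ∫ ω, (w (t + 0) ω).ofLp ⬝ᵥ (w (t + 0) ω).ofLp ∂P := by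
      rw [← integral_indicator_mode hθ]
      refine integral_congr_ae (Filter.Eventually.of_forall fun ω => ?_)
      by_cases hω : θ t ω = i <;> simp [hw, feedback, hK, optimalGain, impulse, hω]
    rw [h0]
    exact Finset.single_le_sum
      (f := fun r => ∫ ω, (w (t + r) ω).ofLp ⬝ᵥ (w (t + r) ω).ofLp ∂P)
      (fun r _ => integral_nonneg fun ω => dotProduct_self_nonneg_real _)
      (Finset.mem_range.2 (Nat.succ_pos k))
  set W := ∑ r ∈ Finset.range (k + 1), ∫ ω, (w (t + r) ω).ofLp ⬝ᵥ (w (t + r) ω).ofLp ∂P with hW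
  have hW0 : 0 ≤ W :=
    Finset.sum_nonneg fun l _ => integral_nonneg fun ω => dotProduct_self_nonneg_real _
  have houtsum := Finset.sum_le_sum fun r (_ : r ∈ Finset.range (k + 1)) => hout r
  rw [Finset.sum_add_distrib, ← Finset.mul_sum, ← Finset.mul_sum] at houtsum
  rw [Finset.sum_sub_distrib, ← Finset.mul_sum] at hcost
  have hη1 : 0 ≤ 1 + η := by linarith
  have hηb : 0 ≤ (1 + 1 / η) * b := by positivity
  have k1 := mul_le_mul_of_nonneg_left hfsum hηb
  have k2 := mul_le_mul_of_nonneg_left ((le_add_of_nonneg_left hz0).trans hsum) hη1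
  have k3 := mul_le_mul_of_nonneg_right hγη hW0
  have k4 := mul_le_mul_of_nonneg_left hwt hε
  refine le_of_mul_le_mul_left ?_ (hpos i t)
  rw [hcost]
  simp only [hf] at houtsum
  linarith

end SMJLS

/-! ### Consequences of the one-step bound -/

namespace SMJLS

variable {n m p N J : ℕ} {S : SMJLS n m p N J}

section Recursions

variable {ψ : ℕ → Fin J} {ε C₀ : ℝ}

/-- The one-step bound that makes the Riccati recursion along `ψ` well posed and bounded. -/
def StepCostBounded (S : SMJLS n m p N J) (ψ : ℕ → Fin J) (ε C₀ : ℝ) : Prop :=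
  ∀ k, (∀ k' < k, ∀ t i, IsUnit (S.inputWeight ε i
      (S.meanNext (ψ t) i (S.value ε k' (tailSeq ψ (t + 1))))).det) →
    ∀ t i x u, S.stepCost ε i (S.meanNext (ψ t) i (S.value ε k (tailSeq ψ (t + 1)))) x u ≤
      C₀ * (x ⬝ᵥ x) - ε * (u ⬝ᵥ u)

theorem isSymm_meanNext_value (ε : ℝ) (k : ℕ) (σ : ℕ → Fin J) (s : Fin J) (i : Fin N) :
    (S.meanNext s i (S.value ε k σ)).IsSymm :=
  S.isSymm_meanNext _ _ fun j => S.isSymm_value ε k σ j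

/-- At `x = 0` the bound says that the input weight is at least `ε`. Strong induction on the horizon
breaks the circle: the bound at `k` needs invertibility only at shorter horizons. -/
theorem StepCostBounded.posDef_inputWeight (h : StepCostBounded S ψ ε C₀) (hε : 0 < ε) (k t : ℕ)
    (i : Fin N) :
    (S.inputWeight ε i (S.meanNext (ψ t) i (S.value ε k (tailSeq ψ (t + 1))))).PosDef := by
  induction k using Nat.strong_induction_on generalizing t i with
  | _ k ih =>
    have hZ := isSymm_meanNext_value (S := S) ε k (tailSeq ψ (t + 1)) (ψ t) i
    refine posDef_iff_quad.2 ⟨isSymm_inputWeight ε i hZ, fun u hu => ?_⟩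
    have hb := h k (fun k' hk' t i =>
      (Matrix.isUnit_iff_isUnit_det _).1 (ih k' hk' t i).isUnit) t i 0 u
    have := mul_pos hε (dotProduct_self_pos_real hu)
    rw [dotProduct_zero, mul_zero] at hb
    rw [quad_inputWeight hZ]
    linarith

theorem StepCostBounded.isUnit_det (h : StepCostBounded S ψ ε C₀) (hε : 0 < ε) (k t : ℕ)
    (i : Fin N) : IsUnit (S.inputWeight ε i
      (S.meanNext (ψ t) i (S.value ε k (tailSeq ψ (t + 1))))).det :=
  (Matrix.isUnit_iff_isUnit_det _).1 (h.posDef_inputWeight hε k t i).isUnit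

theorem value_succ_tailSeq (ε : ℝ) (k t : ℕ) (i : Fin N) :
    S.value ε (k + 1) (tailSeq ψ t) i =
      S.riccati ε i (S.meanNext (ψ t) i (S.value ε k (tailSeq ψ (t + 1)))) := by
  rw [value, tailSeq_succ]
  rfl

theorem StepCostBounded.stepCost_le (h : StepCostBounded S ψ ε C₀) (hε : 0 < ε) (k t : ℕ)
    (i : Fin N) (x : Fin n → ℝ) (u : Fin m → ℝ) :
    S.stepCost ε i (S.meanNext (ψ t) i (S.value ε k (tailSeq ψ (t + 1)))) x u ≤
      quad (S.value ε (k + 1) (tailSeq ψ t) i) x := by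
  rw [stepCost_eq_riccati_sub (isSymm_meanNext_value _ _ _ _ _) (h.isUnit_det hε k t i),
    value_succ_tailSeq]
  have := (posSemidef_iff_quad.1 (h.posDef_inputWeight hε k t i).posSemidef).2
    (u + (-1 : ℝ) • (S.gain ε i
      (S.meanNext (ψ t) i (S.value ε k (tailSeq ψ (t + 1)))) *ᵥ x))
  linarith

theorem StepCostBounded.quad_value_le (h : StepCostBounded S ψ ε C₀) (hε : 0 < ε) (hC₀ : 0 ≤ C₀)
    (k t : ℕ) (i : Fin N) (x : Fin n → ℝ) :
    quad (S.value ε k (tailSeq ψ t) i) x ≤ C₀ * (x ⬝ᵥ x) := by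
  cases k with
  | zero =>
    rw [value, quad_zero]
    exact mul_nonneg hC₀ (dotProduct_self_nonneg_real x)
  | succ k =>
    rw [value_succ_tailSeq, ← stepCost_gain (isSymm_meanNext_value _ _ _ _ _)
      (h.isUnit_det hε k t i)]
    refine (h k (fun k' _ => h.isUnit_det hε k') t i _ _).trans ?_
    exact sub_le_self _ (mul_nonneg hε.le (dotProduct_self_nonneg_real _))

/-- The maximum dominates the cost of the zero input, which is nonnegative. -/
theorem StepCostBounded.quad_value_nonneg (h : StepCostBounded S ψ ε C₀) (hε : 0 < ε)
    (k t : ℕ) (i : Fin N) (x : Fin n → ℝ) : 0 ≤ quad (S.value ε k (tailSeq ψ t) i) x := by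
  induction k generalizing t i x with
  | zero => rw [value, quad_zero]
  | succ k ih =>
    refine le_trans ?_ (h.stepCost_le hε k t i x 0)
    rw [stepCost, dotProduct_zero, mul_zero, sub_zero]
    exact add_nonneg (S.quad_meanNext_nonneg _ _ fun j => ih _ _ _) (dotProduct_self_nonneg_real _)

theorem quad_lyapunov_step_le {C₁ b : ℝ} (hC₁ : 0 < C₁)
    (hL : ∀ k t i x, quad (S.lyapunov k (tailSeq ψ t) i) x ≤ C₁ * (x ⬝ᵥ x))
    (hB : ∀ i u, (S.B i *ᵥ u) ⬝ᵥ (S.B i *ᵥ u) ≤ b * (u ⬝ᵥ u)) (k t : ℕ) (i : Fin N)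
    (x : Fin n → ℝ) (u : Fin m → ℝ) :
    quad (S.meanNext (ψ t) i (S.lyapunov k (tailSeq ψ (t + 1)))) (S.A i *ᵥ x + S.B i *ᵥ u) ≤
      quad (S.lyapunov (k + 1) (tailSeq ψ t) i) x - 1 / 2 * (x ⬝ᵥ x)
        + (1 + 2 * C₁) * C₁ * b * (u ⬝ᵥ u) := by
  have hnn : ∀ x, 0 ≤ quad (S.meanNext (ψ t) i (S.lyapunov k (tailSeq ψ (t + 1)))) x := fun x =>
    S.quad_meanNext_nonneg _ _ fun j =>
      (dotProduct_self_nonneg_real x).trans (S.le_quad_lyapunov _ _ _ _)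
  -- With `η = 1/(2 C₁)` the error term at `A x` is at most half of the decrease `‖x‖²`.
  have h1 := quad_add_vec_le (S.isSymm_meanNext (ψ t) i
    fun j => S.isSymm_lyapunov k (tailSeq ψ (t + 1)) j) hnn
    (η := 1 / (2 * C₁)) (by positivity) (S.A i *ᵥ x) (S.B i *ᵥ u)
  have h2 : quad (S.lyapunov (k + 1) (tailSeq ψ t) i) x = x ⬝ᵥ x +
      quad (S.meanNext (ψ t) i (S.lyapunov k (tailSeq ψ (t + 1)))) (S.A i *ᵥ x) := by
    rw [quad_lyapunov_succ, tailSeq_succ]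
    rfl
  have h3 : quad (S.meanNext (ψ t) i (S.lyapunov k (tailSeq ψ (t + 1)))) (S.B i *ᵥ u) ≤
      C₁ * (b * (u ⬝ᵥ u)) :=
    (S.quad_meanNext_le _ _ fun j => hL k (t + 1) j _).trans
      (mul_le_mul_of_nonneg_left (hB i u) hC₁.le)
  have h4 := mul_le_mul_of_nonneg_left h3 (show 0 ≤ 1 + 2 * C₁ by positivity)
  have h5 := mul_le_mul_of_nonneg_left (hL (k + 1) t i x)
    (show 0 ≤ 1 / (2 * C₁) by positivity)
  have h6 : 1 / (2 * C₁) * (C₁ * (x ⬝ᵥ x)) = 1 / 2 * (x ⬝ᵥ x) := by field_simp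
  have h7 := mul_nonneg (show 0 ≤ 1 / (2 * C₁) by positivity) (dotProduct_self_nonneg_real x)
  rw [one_div_one_div] at h1
  have h8 : quad (S.meanNext (ψ t) i (S.lyapunov k (tailSeq ψ (t + 1)))) (S.A i *ᵥ x) =
    quad (S.lyapunov (k + 1) (tailSeq ψ t) i) x - x ⬝ᵥ x := by linarith
  rw [h8] at h1
  linarith

end Recursions

/-! ### Averaging finite-horizon storage functions -/

/-- A sequence of finite-horizon storage functions, the `k`-th of which depends only on the first
`k` entries of the switching sequence. -/
structure FiniteHorizonStorage (S : SMJLS n m p N J)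
    (V : ℕ → (ℕ → Fin J) → Fin N → Matrix (Fin n) (Fin n) ℝ) (μ ν C : ℝ) : Prop where
  congr : ∀ k σ τ, (∀ l < k, σ l = τ l) → V k σ = V k τ
  isSymm : ∀ k σ i, (V k σ i).IsSymm
  lower : ∀ ψ ∈ S.Psi, ∀ k t i x, ν * (x ⬝ᵥ x) ≤ quad (V k (tailSeq ψ t) i) x
  upper : ∀ ψ ∈ S.Psi, ∀ k t i x, quad (V k (tailSeq ψ t) i) x ≤ C * (x ⬝ᵥ x)
  step : ∀ ψ ∈ S.Psi, ∀ k t i x u,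
    quad (S.meanNext (ψ t) i (V k (tailSeq ψ (t + 1)))) (S.A i *ᵥ x + S.B i *ᵥ u)
      + (S.C i *ᵥ x + S.D i *ᵥ u) ⬝ᵥ (S.C i *ᵥ x + S.D i *ᵥ u) - u ⬝ᵥ u ≤
    quad (V (k + 1) (tailSeq ψ t) i) x - μ * (x ⬝ᵥ x + u ⬝ᵥ u)

/-- The average of the storage functions with horizons below `M`. -/
noncomputable def average (V : ℕ → (ℕ → Fin J) → Fin N → Matrix (Fin n) (Fin n) ℝ) (M : ℕ)
    (σ : ℕ → Fin J) (i : Fin N) : Matrix (Fin n) (Fin n) ℝ :=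
  (M : ℝ)⁻¹ • ∑ k ∈ Finset.range M, V k σ i

theorem quad_average (V : ℕ → (ℕ → Fin J) → Fin N → Matrix (Fin n) (Fin n) ℝ) (M : ℕ)
    (σ : ℕ → Fin J) (i : Fin N) (x : Fin n → ℝ) :
    quad (average V M σ i) x = (M : ℝ)⁻¹ * ∑ k ∈ Finset.range M, quad (V k σ i) x := by
  rw [average, quad_smul, quad_sum]

theorem isSymm_average {V : ℕ → (ℕ → Fin J) → Fin N → Matrix (Fin n) (Fin n) ℝ}
    (hV : ∀ k σ i, (V k σ i).IsSymm) (M : ℕ) (σ : ℕ → Fin J) (i : Fin N) :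
    (average V M σ i).IsSymm := by
  rw [Matrix.IsSymm, average, Matrix.transpose_smul, Matrix.transpose_sum]
  exact congrArg _ (Finset.sum_congr rfl fun k _ => (hV k σ i).eq)

theorem FiniteHorizonStorage.exists_brl
    {V : ℕ → (ℕ → Fin J) → Fin N → Matrix (Fin n) (Fin n) ℝ} {μ ν C : ℝ}
    (hV : FiniteHorizonStorage S V μ ν C) (hμ : 0 < μ) (hν : 0 < ν) :
    ∃ (M : ℕ) (X : Fin N → S.windows M → Matrix (Fin n) (Fin n) ℝ),
      (∀ i r, (X i r).PosDef) ∧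
      ∀ (r : S.windows (M + 1)) (i : Fin N),
        (-(S.brl i (∑ j : Fin N, S.trans (r.1 0) i j • X j (S.tailWindow r))
            (X i (S.initWindow r)))).PosDef := by
  -- The maximum with zero ensures `M > 0` whatever the sign of `C`.
  obtain ⟨M, hM⟩ := exists_nat_gt (max (C / μ) 0)
  have hM0 : (0 : ℝ) < M := (le_max_right _ _).trans_lt hM
  have hMC : C < μ * M := by
    have := (le_max_left _ _).trans_lt hM
    rwa [div_lt_iff₀ hμ, mul_comm] at this
  have hcongr : ∀ {σ τ : ℕ → Fin J}, (∀ l < M, σ l = τ l) → average V M σ = average V M τ := by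
    intro σ τ h
    funext i
    rw [average, average]
    congr 1
    refine Finset.sum_congr rfl fun k hk => ?_
    rw [hV.congr k σ τ fun l hl => h l (hl.trans (Finset.mem_range.1 hk))]
  -- Any occurrence of a window may represent it, since by `hcongr` the average depends only on the
  -- window.
  choose f hf t ht using fun r : S.windows M => r.2
  refine ⟨M, fun i r => average V M (tailSeq (f r) (t r)) i, fun i r => ?_, fun r i => ?_⟩
  · refine posDef_iff_quad.2 ⟨isSymm_average hV.isSymm _ _ _, fun x hx => ?_⟩
    rw [quad_average]
    have hpos : ∀ k, 0 < quad (V k (tailSeq (f r) (t r)) i) x := fun k =>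
      (mul_pos hν (dotProduct_self_pos_real hx)).trans_le (hV.lower _ (hf r) k (t r) i x)
    refine mul_pos (inv_pos.2 hM0) (Finset.sum_pos (fun k _ => hpos k) ?_)
    exact Finset.nonempty_range_iff.2 (by exact_mod_cast hM0.ne')
  · obtain ⟨ψ, hψ, s, hs⟩ := r.2
    have hinit : average V M (tailSeq (f (S.initWindow r)) (t (S.initWindow r))) =
        average V M (tailSeq ψ s) := hcongr fun l hl => by
      have h1 := congrFun (ht (S.initWindow r)) ⟨l, hl⟩
      have h2 := congrFun hs (Fin.castSucc ⟨l, hl⟩)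
      exact h1.symm.trans h2
    have htail : average V M (tailSeq (f (S.tailWindow r)) (t (S.tailWindow r))) =
        average V M (tailSeq ψ (s + 1)) := hcongr fun l hl => by
      have h1 := congrFun (ht (S.tailWindow r)) ⟨l, hl⟩
      have h2 := congrFun hs (Fin.succ ⟨l, hl⟩)
      refine h1.symm.trans (h2.trans ?_)
      simp only [tailSeq, Fin.val_succ]
      congr 1
      omega
    have hr : r.1 0 = ψ s := by rw [hs]; rfl
    have hrw : (∑ j : Fin N, S.trans (r.1 0) i j •
        average V M (tailSeq (f (S.tailWindow r)) (t (S.tailWindow r))) j) =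
        S.meanNext (ψ s) i (average V M (tailSeq ψ (s + 1))) := by
      rw [hr, htail]
      rfl
    simp only [hrw, hinit]
    refine posDef_iff_quad.2 ⟨?_, fun y hy => ?_⟩
    · rw [Matrix.IsSymm, Matrix.transpose_neg, (S.isSymm_brl i (S.isSymm_meanNext _ _ fun j =>
        isSymm_average hV.isSymm _ _ _) (isSymm_average hV.isSymm _ _ _)).eq]
    obtain ⟨x, u, rfl⟩ : ∃ x u, y = Sum.elim x u := ⟨_, _, (Sum.elim_comp_inl_inr y).symm⟩
    have hxu : 0 < x ⬝ᵥ x + u ⬝ᵥ u := by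
      have := dotProduct_self_pos_real hy
      rwa [sumElim_dotProduct_sumElim] at this
    rw [quad_neg, quad_brl]
    have hsum := Finset.sum_le_sum fun k (_ : k ∈ Finset.range M) => hV.step ψ hψ k s i x u
    simp only [Finset.sum_sub_distrib, Finset.sum_add_distrib, Finset.sum_const,
      Finset.card_range, nsmul_eq_mul] at hsum
    have hshift : ∑ k ∈ Finset.range M, quad (V (k + 1) (tailSeq ψ s) i) x =
        ∑ k ∈ Finset.range M, quad (V k (tailSeq ψ s) i) x +
          (quad (V M (tailSeq ψ s) i) x - quad (V 0 (tailSeq ψ s) i) x) := by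
      rw [← Finset.sum_range_sub (fun k => quad (V k (tailSeq ψ s) i) x), ← Finset.sum_add_distrib]
      exact Finset.sum_congr rfl fun k _ => by ring
    have hmean : quad (S.meanNext (ψ s) i (average V M (tailSeq ψ (s + 1))))
        (S.A i *ᵥ x + S.B i *ᵥ u) = (M : ℝ)⁻¹ * ∑ k ∈ Finset.range M,
          quad (S.meanNext (ψ s) i (V k (tailSeq ψ (s + 1)))) (S.A i *ᵥ x + S.B i *ᵥ u) := by
      simp only [quad_meanNext, quad_average]
      rw [Finset.sum_comm, Finset.mul_sum]
      refine Finset.sum_congr rfl fun j _ => ?_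
      rw [← Finset.mul_sum]
      ring
    have hup := hV.upper ψ hψ M s i x
    have hlow := hV.lower ψ hψ 0 s i x
    have hxx := dotProduct_self_nonneg_real x
    have huu := dotProduct_self_nonneg_real u
    have hν0 := mul_nonneg hν.le hxx
    rw [hmean, quad_average]
    refine pos_of_mul_pos_right (b := _) (a := (M : ℝ)) ?_ hM0.le
    have e : ∀ a b c d : ℝ, (M : ℝ) * -((M : ℝ)⁻¹ * a + b - (M : ℝ)⁻¹ * c - d) =
        -(a + M * b - c - M * d) := fun a b c d => by
      field_simp
    rw [e]
    -- The choice of `M` is strict only for `x ≠ 0`; for `x = 0` strictness comes from `u ≠ 0`.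
    have hfin : C * (x ⬝ᵥ x) < M * (μ * (x ⬝ᵥ x + u ⬝ᵥ u)) := by
      obtain hx0 | hx0 := hxx.eq_or_lt
      · rw [← hx0, mul_zero]
        rw [← hx0] at hxu
        positivity
      · have h1 := mul_lt_mul_of_pos_right hMC hx0
        have h2 : 0 ≤ M * (μ * (u ⬝ᵥ u)) := by positivity
        linarith
    linarith

theorem exists_finiteHorizonStorage {Ω : Type*} [MeasurableSpace Ω] {P : Measure Ω}
    [IsProbabilityMeasure P] {θ : (ℕ → Fin J) → ℕ → Ω → Fin N}
    (hθ : ∀ ψ ∈ S.Psi, IsMarkovChain P (fun k => S.trans (ψ k)) S.p0 (θ ψ))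
    (hpos : ∀ ψ ∈ S.Psi, ∀ (i : Fin N) (k : ℕ), 0 < P.real {ω | θ ψ k ω = i})
    (hstab : S.UniformlyExpMeanSquareStable P θ)
    (hcontr : S.UniformlyMeanSquareStrictlyContractive P θ) :
    ∃ V μ ν C, FiniteHorizonStorage S V μ ν C ∧ 0 < μ ∧ 0 < ν := by
  obtain ⟨c, lam, hc, hlam0, hlam1, hstab⟩ := hstab
  obtain ⟨γ, hγ0, hγ1, hcontr⟩ := hcontr
  have hgram : ∀ ψ ∈ S.Psi, ∀ t i s x,
      quad (S.condGram P (θ ψ) (t + s) t i) x ≤ c * lam ^ s * (x ⬝ᵥ x) := by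
    intro ψ hψ t i s x
    have := (posSemidef_iff_quad.1 (hstab ψ hψ i (t + s) t (Nat.le_add_right t s))).2 x
    rw [quad_sub, quad_smul, quad_one, Nat.add_sub_cancel_left] at this
    linarith
  obtain ⟨b, hb, hC⟩ := exists_mulVec_le S.C
  obtain ⟨b', hb', hB⟩ := exists_mulVec_le S.B
  have hγsq : γ ^ 2 < 1 := by nlinarith
  -- These values make both `(1 + η) γ²` and `1 - 2ε` equal to `(1 + γ²)/2`.
  set ε : ℝ := (1 - γ ^ 2) / 4 with hε
  set η : ℝ := (1 - γ ^ 2) / (2 * γ ^ 2) with hη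
  have hε0 : 0 < ε := by
    rw [hε]
    linarith
  have hη0 : 0 < η := div_pos (by linarith) (by positivity)
  have hγη : (1 + η) * γ ^ 2 ≤ 1 - 2 * ε := by
    rw [hη, hε]
    apply le_of_eq
    field_simp
    ring
  have hc0 : 0 ≤ c := by linarith
  have h1lam : 0 < 1 - lam := by linarith
  set C₁ : ℝ := c / (1 - lam) with hC₁
  have hC₁0 : 0 < C₁ := div_pos (by linarith) h1lam
  set C₀ : ℝ := (1 + 1 / η) * b * C₁ with hC₀
  have hC₀0 : 0 ≤ C₀ := by positivity
  have hbdd : ∀ ψ ∈ S.Psi, StepCostBounded S ψ ε C₀ := fun ψ hψ k hdet t i x u =>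
    stepCost_value_le (hθ ψ hψ) (hpos ψ hψ) hlam0 hlam1 hc0 (hgram ψ hψ) hγ0.le (hcontr ψ hψ)
      hb.le hC hε0.le hη0 hγη hdet t i x u
  have hlyap : ∀ ψ ∈ S.Psi, ∀ k t i x,
      quad (S.lyapunov k (tailSeq ψ t) i) x ≤ C₁ * (x ⬝ᵥ x) := fun ψ hψ k t i x =>
    quad_lyapunov_le hlam0 hlam1 hc0 (hθ ψ hψ) (hpos ψ hψ i t) (hgram ψ hψ t i) k x
  set κ : ℝ := (1 + 2 * C₁) * C₁ * b' with hκ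
  have hκ0 : 0 < κ := by positivity
  -- The Lyapunov term costs `δ κ ‖u‖²`; this choice spends half of the margin `ε ‖u‖²` left by the
  -- value function and gains `δ/2` times `‖x‖²`.
  set δ : ℝ := ε / (2 * κ) with hδ
  have hδ0 : 0 < δ := by positivity
  have hδκ : δ * κ = ε / 2 := by
    rw [hδ]
    field_simp
  refine ⟨fun k σ i => S.value ε k σ i + δ • S.lyapunov k σ i, min (δ / 2) (ε / 2), δ,
    C₀ + δ * C₁, ⟨?_, ?_, ?_, ?_, ?_⟩, by positivity, hδ0⟩
  · intro k σ τ h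
    simp only [S.value_congr ε k h, S.lyapunov_congr k h]
  · intro k σ i
    rw [Matrix.IsSymm, Matrix.transpose_add, Matrix.transpose_smul, (S.isSymm_value ε k σ i).eq,
      (S.isSymm_lyapunov k σ i).eq]
  · intro ψ hψ k t i x
    have h1 := (hbdd ψ hψ).quad_value_nonneg hε0 k t i x
    have h2 := mul_le_mul_of_nonneg_left (S.le_quad_lyapunov k (tailSeq ψ t) i x) hδ0.le
    rw [quad_add, quad_smul]
    linarith
  · intro ψ hψ k t i x
    have h1 := (hbdd ψ hψ).quad_value_le hε0 hC₀0 k t i x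
    have h2 := mul_le_mul_of_nonneg_left (hlyap ψ hψ k t i x) hδ0.le
    rw [quad_add, quad_smul]
    linarith
  · intro ψ hψ k t i x u
    have h1 := (hbdd ψ hψ).stepCost_le hε0 k t i x u
    have h2 := mul_le_mul_of_nonneg_left
      (quad_lyapunov_step_le hC₁0 (hlyap ψ hψ) hB k t i x u) hδ0.le
    have hsplit : quad (S.meanNext (ψ t) i fun j => S.value ε k (tailSeq ψ (t + 1)) j +
        δ • S.lyapunov k (tailSeq ψ (t + 1)) j) (S.A i *ᵥ x + S.B i *ᵥ u) =
        quad (S.meanNext (ψ t) i (S.value ε k (tailSeq ψ (t + 1)))) (S.A i *ᵥ x + S.B i *ᵥ u) +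
        δ * quad (S.meanNext (ψ t) i (S.lyapunov k (tailSeq ψ (t + 1))))
          (S.A i *ᵥ x + S.B i *ᵥ u) := by
      simp only [quad_meanNext, quad_add, quad_smul, mul_add, Finset.sum_add_distrib,
        Finset.mul_sum, mul_left_comm δ]
    rw [quad_add, quad_smul, hsplit]
    rw [stepCost] at h1
    have h3 := mul_le_mul_of_nonneg_right (min_le_left (δ / 2) (ε / 2))
      (dotProduct_self_nonneg_real x)
    have h4 := mul_le_mul_of_nonneg_right (min_le_right (δ / 2) (ε / 2))
      (dotProduct_self_nonneg_real u)
    have h5 : δ * (κ * (u ⬝ᵥ u)) = ε / 2 * (u ⬝ᵥ u) := by rw [← mul_assoc, hδκ]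
    linarith

end SMJLS

theorem mainTheorem1 {n m p N J : ℕ} (S : SMJLS n m p N J)
    {Ω : Type*} [MeasurableSpace Ω] (P : Measure Ω) [IsProbabilityMeasure P]
    (θ : (ℕ → Fin J) → ℕ → Ω → Fin N)
    (hθ : ∀ ψ ∈ S.Psi, IsMarkovChain P (fun k => S.trans (ψ k)) S.p0 (θ ψ))
    (hpos : ∀ ψ ∈ S.Psi, ∀ (i : Fin N) (k : ℕ), 0 < P.real {ω | θ ψ k ω = i}) :
    (S.UniformlyExpMeanSquareStable P θ ∧ S.UniformlyMeanSquareStrictlyContractive P θ) ↔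
      ∃ (M : ℕ) (X : Fin N → S.windows M → Matrix (Fin n) (Fin n) ℝ),
        (∀ i r, (X i r).PosDef) ∧
        ∀ (r : S.windows (M + 1)) (i : Fin N),
          (-(S.brl i (∑ j : Fin N, S.trans (r.1 0) i j • X j (S.tailWindow r))
              (X i (S.initWindow r)))).PosDef := by
  constructor
  · rintro ⟨hstab, hcontr⟩
    obtain ⟨V, μ, ν, C, hV, hμ, hν⟩ := SMJLS.exists_finiteHorizonStorage hθ hpos hstab hcontr
    exact hV.exists_brl hμ hν
  · rintro ⟨M, X, hX, hbrl⟩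
    exact SMJLS.stable_and_contractive_of_brl hθ hpos M X hX hbrl
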